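/- Let $M$ be the interior of a compact oriented 3-manifold $\overline M$ whose boundary is a union of tori $T_1,\dots,T_c$ (the cusps), with an ideal triangulation $\tau$ by finitely many tetrahedra: $\overline M$ is obtained by gluing truncated tetrahedra in pairs along all their hexagonal faces, so that $\partial\overline M$ is triangulated by the truncation triangles. Assign a real angle to each pair of opposite edges of each tetrahedron; a corner of a truncation triangle gets the angle of the tetrahedron edge that ends there. The angles $(\theta)$ form an angle structure (in the generalized sense) if the three angles of each tetrahedron add up to $\pi$ and the angles around each edge of $M$ add up to $2\pi$. It is nonnegative if all angles are $\ge 0$, and taut if all angles are $0$ (thin) or $\pi$ (wide). A taut structure is veering if at each vertex $v$ of the triangulation of $\partial\overline M$, either all triangles with a thin angle at $v$ have their $\pi$-angle immediately before $v$ in the counterclockwise order of their corners ($v$ is blue), or all of them have it immediately after $v$ ($v$ is red). Edges of $\partial\overline M$ joining two vertices of the same color are ladderpole segments and the other ones are rungs. The ladderpole segments form disjoint simple closed curves, the ladderpoles, which cut each $T_i$ into annuli, the ladders. A taut structure is transverse-taut if the faces of $\tau$ have transverse orientations such that in each tetrahedron the two faces sharing one of the wide edges are oriented inward and the two faces sharing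 the other wide edge are oriented outward. An oriented simple closed curve $\gamma\subset\partial\overline M$ is normal if it is transverse to the edges of $\partial\overline M$ and enters and leaves each triangle that it meets through different sides. It then cuts off one corner each time it crosses a triangle. If $\gamma$ is not null-homologous, the angular holonomy of its class is $h_\theta([\gamma])=\mathcal A_\gamma-\mathcal B_\gamma$, where $\mathcal A_\gamma$ and $\mathcal B_\gamma$ are the sums of the angles of the corners cut off to the left and to the right of $\gamma$, respectively. Suppose that $\tau$ carries a veering structure that is transverse-taut, with chosen transverse orientations. For each $i$, let $\ell_i\subset T_i$ be an oriented simple closed normal curve along the ladderpole direction, that is, one that runs once around a ladder of $T_i$ and crosses only rungs. Suppose that the orientations of the $\ell_i$ all agree with the transverse-taut structure (every $\ell_i$ crosses each rung in the direction of the transverse orientation of the face of $\tau$ containing that rung), or all disagree with it (every $\ell_i$ crosses each rung against that direction). Then for every subset $J\subset\{1,\dots,c\}$ there is a nonnegative angle structure $(\theta)$ on $\tau$ such that $$h_\theta([\ell_i])=\begin{cases}\pi/2 & \text{if } i\in J,\\ 0 & \text{if } i\notin J.\end{cases}$$ -/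

import Mathlib

/-! Combinatorial ideal triangulations of oriented 3-manifolds with torus cusps.

The tetrahedra are the elements of a finite type `T`. The vertices of each tetrahedron are labelled
by `Fin 4` so that the order `0, 1, 2, 3` is the positive orientation (the edge vectors from `0` to
`1, 2, 3` form a positive frame). Face `f` of a tetrahedron is the face opposite vertex `f`.

The truncated tip of `t` at vertex `v` is the cusp triangle `(t, v)`. For `w ≠ v`,
* its corner `w` is the end, at `v`, of the edge `vw` of `t`;
* its side `w` is the trace of face `w` of `t`; it is opposite corner `w`. -/

noncomputable section

/-- The pair of opposite edges of a tetrahedron that contains the edge `vw` (`v ≠ w`; the diagonal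
values are irrelevant): `0` for `{01, 23}`, `1` for `{02, 13}`, `2` for `{03, 12}`. -/
def oppPair (v w : Fin 4) : Fin 3 :=
  (![![0, 0, 1, 2], ![0, 0, 2, 1], ![1, 2, 0, 0], ![2, 1, 0, 0]] : Fin 4 → Fin 4 → Fin 3) v w

/-- The corner following the corner `w ≠ v` in the counterclockwise cyclic order of the corners of
the cusp triangle at the vertex `v`, where the boundary is viewed from the cusp. -/
def ccwNext (v w : Fin 4) : Fin 4 :=
  (![![0, 3, 1, 2], ![2, 1, 3, 0], ![3, 0, 2, 1], ![1, 2, 0, 3]] : Fin 4 → Fin 4 → Fin 4) v w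

/-- The corner preceding the corner `w ≠ v` in the counterclockwise cyclic order of the corners of
the cusp triangle at the vertex `v`. -/
def ccwPrev (v w : Fin 4) : Fin 4 := ccwNext v (ccwNext v w)

/-- Gluing of the oriented tetrahedra in `T` in pairs along all their faces, by orientation-reversing
maps of faces. Face `f` of `t` is glued to face `glue t f f` of `adj t f`, and the vertex
`v ≠ f` of `t` goes to the vertex `glue t f v` of `adj t f`. -/
structure FaceGluing (T : Type*) where
  adj : T → Fin 4 → T
  glue : T → Fin 4 → Equiv.Perm (Fin 4)
  adj_adj : ∀ t f, adj (adj t f) (glue t f f) = t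
  glue_glue : ∀ t f, glue (adj t f) (glue t f f) = (glue t f)⁻¹
  /-- no face is glued to itself -/
  no_self : ∀ t f, ¬ (adj t f = t ∧ glue t f f = f)
  /-- the gluing of faces reverses orientation, so that the quotient is oriented -/
  odd : ∀ t f, Equiv.Perm.sign (glue t f) = -1

/-- A corner of a cusp triangle: `(t, v, w)` is the corner `w` of the cusp triangle `(t, v)`. -/
abbrev Corner (T : Type*) := {c : T × Fin 4 × Fin 4 // c.2.1 ≠ c.2.2}

namespace FaceGluing

variable {T : Type*} (G : FaceGluing T)

/-- Two cusp triangles are adjacent when they are glued along a side. -/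
def TriangleStep (x y : T × Fin 4) : Prop :=
  ∃ a : Fin 4, a ≠ x.2 ∧ y = (G.adj x.1 a, G.glue x.1 a x.2)

/-- The cusps: the connected components of the boundary, as classes of cusp triangles. -/
def Cusp : Type _ := Quot G.TriangleStep

/-- The cusp that contains the cusp triangle at the vertex `v` of `t`. -/
def cuspOf (t : T) (v : Fin 4) : G.Cusp := Quot.mk _ (t, v)

/-- Two corners are adjacent when they are identified by the gluing along a common side. -/
def CornerStep (c d : Corner T) : Prop :=
  ∃ a : Fin 4, a ≠ c.1.2.1 ∧ a ≠ c.1.2.2 ∧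
    d.1 = (G.adj c.1.1 a, G.glue c.1.1 a c.1.2.1, G.glue c.1.1 a c.1.2.2)

/-- Two corners lie at the same vertex of the triangulated boundary. Equivalently, the two edges
`vw` of tetrahedra, directed towards the cusp at `v`, are identified to the same directed edge. -/
def SameVertex : Corner T → Corner T → Prop := Relation.EqvGen G.CornerStep

/-- The vertices of the triangulated boundary. -/
def BoundaryVertex : Type _ := Quot G.CornerStep

/-- The vertices of the triangulated boundary that lie in the cusp `i`. -/
def cuspVertices (i : G.Cusp) : Set G.BoundaryVertex :=
  {x | ∃ c : Corner T, G.cuspOf c.1.1 c.1.2.1 = i ∧ x = Quot.mk _ c}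

/-- The triangles of the cusp `i`. -/
def cuspTriangles (i : G.Cusp) : Set (T × Fin 4) := {x | G.cuspOf x.1 x.2 = i}

end FaceGluing

/-- An ideal triangulation of an oriented 3-manifold with torus cusps. Each cusp is a closed connected
oriented surface; with `V` vertices and `F` triangles it has `3F/2` edges, so that its Euler
characteristic is `V - 3F/2 + F`, and it is a torus if and only if `2V = F`. -/
structure IdealTriangulation (T : Type*) extends FaceGluing T where
  torus : ∀ i : toFaceGluing.Cusp,
    2 * (toFaceGluing.cuspVertices i).ncard = (toFaceGluing.cuspTriangles i).ncard

/-- The angle at a corner, when an angle is assigned to every pair of opposite edges of every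
tetrahedron. -/
def cornerAngle {T : Type*} (θ : T → Fin 3 → ℝ) (t : T) (v w : Fin 4) : ℝ := θ t (oppPair v w)

/-- An oriented arc that crosses the cusp triangle `(tet, tip)`; it enters through the side `enter`
and leaves through the different side `exit`. -/
structure NormalArc (T : Type*) where
  tet : T
  tip : Fin 4
  enter : Fin 4
  exit : Fin 4
  enter_ne_tip : enter ≠ tip
  exit_ne_tip : exit ≠ tip
  enter_ne_exit : enter ≠ exit

namespace NormalArc

variable {T : Type*} (x : NormalArc T) (θ : T → Fin 3 → ℝ)

/-- The arc cuts off the corner common to the sides it crosses. This is the corner preceding `enter`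
and following `exit`, and it lies to the right of the arc, if `exit` follows `enter`
counterclockwise; otherwise it is the corner following `enter`, and it lies to the left.
This is the angle cut off to the left (`0` if the corner lies to the right). -/
def leftAngle : ℝ :=
  if ccwPrev x.tip x.enter = x.exit then cornerAngle θ x.tet x.tip (ccwNext x.tip x.enter) else 0

/-- The angle cut off to the right of the arc (`0` if the corner lies to the left). -/
def rightAngle : ℝ :=
  if ccwNext x.tip x.enter = x.exit then cornerAngle θ x.tet x.tip (ccwPrev x.tip x.enter) else 0

end NormalArc

namespace IdealTriangulation

variable {T : Type*} (τ : IdealTriangulation T)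

open scoped Classical in
/-- Generalized angle structure: the three angles of a tetrahedron have sum `π`, and the angles
around each interior edge have sum `2π`. (A directed edge is never identified to its own reverse,
because the gluing is orientable. So the edges of tetrahedra around an interior edge, directed
coherently, are the members of one class of `SameVertex`, each counted once.) -/
def IsAngleStructure [Fintype T] (θ : T → Fin 3 → ℝ) : Prop :=
  (∀ t, θ t 0 + θ t 1 + θ t 2 = Real.pi) ∧
  ∀ c : Corner T, ∑ d : Corner T with τ.SameVertex c d,
    cornerAngle θ d.1.1 d.1.2.1 d.1.2.2 = 2 * Real.pi

/-- Nonnegative angle structure. -/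
def IsNonnegAngleStructure [Fintype T] (θ : T → Fin 3 → ℝ) : Prop :=
  τ.IsAngleStructure θ ∧ ∀ t j, 0 ≤ θ t j

/-- Taut angle structure: all angles are `0` (thin) or `π` (wide). -/
def IsTaut [Fintype T] (α : T → Fin 3 → ℝ) : Prop :=
  τ.IsAngleStructure α ∧ ∀ t j, α t j = 0 ∨ α t j = Real.pi

/-- The vertex of the corner `c` is left-veering (blue) for the taut structure `α`: each triangle
with a thin angle at this vertex has its `π`-angle immediately before it, counterclockwise. -/
def LeftVeering (α : T → Fin 3 → ℝ) (c : Corner T) : Prop :=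
  ∀ d : Corner T, τ.SameVertex c d → cornerAngle α d.1.1 d.1.2.1 d.1.2.2 = 0 →
    cornerAngle α d.1.1 d.1.2.1 (ccwPrev d.1.2.1 d.1.2.2) = Real.pi

/-- The vertex of the corner `c` is right-veering (red) for the taut structure `α`: each triangle
with a thin angle at this vertex has its `π`-angle immediately after it, counterclockwise. -/
def RightVeering (α : T → Fin 3 → ℝ) (c : Corner T) : Prop :=
  ∀ d : Corner T, τ.SameVertex c d → cornerAngle α d.1.1 d.1.2.1 d.1.2.2 = 0 →
    cornerAngle α d.1.1 d.1.2.1 (ccwNext d.1.2.1 d.1.2.2) = Real.pi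

/-- Veering structure: a taut angle structure for which each vertex of the triangulated boundary is
left-veering or right-veering. -/
def IsVeering [Fintype T] (α : T → Fin 3 → ℝ) : Prop :=
  τ.IsTaut α ∧ ∀ c : Corner T, τ.LeftVeering α c ∨ τ.RightVeering α c

/-- A transverse orientation of the faces that makes the taut structure `α` transverse-taut:
`inward t f` says that the orientation of face `f` points into `t`. It then points out of the
tetrahedron on the other side. At each wide edge `vw` of `t`, the two faces `a`, `b` that share `vw`
point the same way, and the two faces `v`, `w` that share the opposite edge `ab` point the other way
(in or out). -/
def IsTransverseTaut (α : T → Fin 3 → ℝ) (inward : T → Fin 4 → Prop) : Prop :=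
  (∀ t f, inward (τ.adj t f) (τ.glue t f f) ↔ ¬ inward t f) ∧
  ∀ (t : T) (v w a b : Fin 4), [v, w, a, b].Nodup → cornerAngle α t v w = Real.pi →
    ((inward t a ↔ inward t b) ∧ (inward t v ↔ inward t w) ∧ (inward t a ↔ ¬ inward t v))

/-- The side `a` of the cusp triangle `(t, v)` is a rung: of its two endpoints (the corners other
than `a`), one is blue and the other is red. (The other sides, with endpoints of the same color, are
the ladderpole segments. They form disjoint closed curves, the ladderpoles, which cut the boundary into
annuli, the ladders.) -/
def IsRung (α : T → Fin 3 → ℝ) (t : T) (v a : Fin 4) : Prop :=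
  ∃ p q : Corner T, p.1.1 = t ∧ p.1.2.1 = v ∧ p.1.2.2 ≠ a ∧ q.1.1 = t ∧ q.1.2.1 = v ∧ q.1.2.2 ≠ a ∧
    τ.LeftVeering α p ∧ τ.RightVeering α q

/-- An oriented closed normal curve in the boundary, described by the cyclic sequence of arcs in which
it crosses the cusp triangles, indexed by `ℕ` with the period `length`. -/
structure NormalCurve where
  length : ℕ
  length_pos : 0 < length
  arc : ℕ → NormalArc T
  periodic : ∀ k, arc (k + length) = arc k
  /-- each arc starts on the side on which the preceding arc ends -/
  tet_succ : ∀ k, (arc (k + 1)).tet = τ.adj (arc k).tet (arc k).exit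
  tip_succ : ∀ k, (arc (k + 1)).tip = τ.glue (arc k).tet (arc k).exit (arc k).tip
  enter_succ : ∀ k, (arc (k + 1)).enter = τ.glue (arc k).tet (arc k).exit (arc k).exit

namespace NormalCurve

variable {τ} (ℓ : τ.NormalCurve)

/-- The sum of the angles to the left of the curve. -/
def leftSum (θ : T → Fin 3 → ℝ) : ℝ := ∑ k ∈ Finset.range ℓ.length, (ℓ.arc k).leftAngle θ

/-- The sum of the angles to the right of the curve. -/
def rightSum (θ : T → Fin 3 → ℝ) : ℝ := ∑ k ∈ Finset.range ℓ.length, (ℓ.arc k).rightAngle θ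

/-- The turning angle of the curve: the sum of the angles to its left minus the sum of the angles to
its right. For a simple closed normal curve `ℓ` that is not null-homologous this is, by definition, the
angular holonomy of the homology class of `ℓ`. -/
def holonomy (θ : T → Fin 3 → ℝ) : ℝ := ℓ.leftSum θ - ℓ.rightSum θ

/-- The curve lies in the cusp `i`. -/
def InCusp (i : τ.Cusp) : Prop := ∀ k, τ.cuspOf (ℓ.arc k).tet (ℓ.arc k).tip = i

/-- The curve is a simple closed curve along the ladderpole direction: it never crosses a
ladderpole, that is, it crosses rungs only, and so it stays in one ladder; and it goes around this
annulus once, that is, it does not come back to a triangle within a period. -/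
def IsAlongLadder (α : T → Fin 3 → ℝ) : Prop :=
  (∀ k, τ.IsRung α (ℓ.arc k).tet (ℓ.arc k).tip (ℓ.arc k).exit) ∧
  ∀ j k, j < ℓ.length → k < ℓ.length →
    (ℓ.arc j).tet = (ℓ.arc k).tet → (ℓ.arc j).tip = (ℓ.arc k).tip → j = k

/-- The orientation of the curve agrees with the transverse orientation: the curve goes up, that is,
it crosses each rung in the direction of the transverse orientation of the face that contains it. -/
def Agrees (inward : T → Fin 4 → Prop) : Prop := ∀ k, ¬ inward (ℓ.arc k).tet (ℓ.arc k).exit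

/-- The orientation of the curve disagrees with the transverse orientation: the curve crosses each
rung against the transverse orientation of the face that contains it. -/
def Disagrees (inward : T → Fin 4 → Prop) : Prop := ∀ k, inward (ℓ.arc k).tet (ℓ.arc k).exit

end NormalCurve

end IdealTriangulation

end

/-! The angles are obtained by deforming the taut structure `α` along a flow on the triangulated
boundary: a flow is an antisymmetric amount through each side, conserved in each triangle, and each
corner gains what flows in through the opposite side. By telescoping, such a deformation preserves
the angle sums of tetrahedra and edges (`IsFlow.sum_tetrahedron`, `IsFlow.sum_vertex`), and its
effect on the holonomy of a normal curve depends only on the flow in the triangles which the curve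
crosses (`holonomy_flowAngle`).

In a cusp triangle let `apex` be the wide corner, `fore` the thin corner of the same colour and
`base` the thin corner of the other colour. The side opposite `base` is the ladderpole segment.
Crossing the side opposite `fore` gives a permutation `step` whose cycles are the ladders; crossing
the ladderpole segment gives an involution `flip`. A triangle is in `L` when its ladderpole segment
lies to the left of the upward direction of its ladder. A ladder curve cuts off only `base` corners,
which are thin, so `α` has holonomy zero along it.

The flow sends `r = π/4` backwards along every ladder, minus a stream of tokens. A token moves by
`step` and crosses the ladderpole whenever it arrives in `L`. All left neighbours of a ladder lie in
one ladder (`sameCycle_flip`), and the resulting map of ladders is injective. Hence some periodic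
token orbit meets the ladder of a given curve, and it can be weighted so that the total leaving this
ladder is 1 (`exists_invariant_weight`). Tokens are used only in the cusps of `J`. The inflows
through ladderpole segments sum to zero over a ladder, and count with opposite signs on its two
sides; the holonomy is therefore `2r` times the token weight leaving, that is `π/2` or `0`.

Nonnegativity: a wide angle loses at most `r` at each of its four tips, so at most `π` in all. For
thin angles (`flowAngle_thin`), a negative contribution can come only from a triangle of `L` whose
predecessor in the ladder has the other colour; the two wide edges of its tetrahedron then differ in
colour, and two other tips contribute `r` each to compensate. -/

noncomputable section

/-! ### The combinatorics of one tetrahedron -/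

/-- The other end of the edge at `v` that belongs to the pair `j` of opposite edges. -/
def oppVertex (j : Fin 3) (v : Fin 4) : Fin 4 :=
  (![![1, 0, 3, 2], ![2, 3, 0, 1], ![3, 2, 1, 0]] : Fin 3 → Fin 4 → Fin 4) j v

lemma oppVertex_ne (j : Fin 3) (v : Fin 4) : oppVertex j v ≠ v := by
  revert j v; decide

lemma oppVertex_oppVertex (j : Fin 3) (v : Fin 4) : oppVertex j (oppVertex j v) = v := by
  revert j v; decide

lemma oppPair_oppVertex (j : Fin 3) (v : Fin 4) : oppPair v (oppVertex j v) = j := by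
  revert j v; decide

lemma oppVertex_oppPair {v w : Fin 4} (h : w ≠ v) : oppVertex (oppPair v w) v = w := by
  revert v w; decide

lemma oppPair_comm (v w : Fin 4) : oppPair v w = oppPair w v := by
  revert v w; decide

lemma ccwNext_ne_tip {v w : Fin 4} (h : w ≠ v) : ccwNext v w ≠ v := by
  revert v w; decide

lemma ccwPrev_ne_tip {v w : Fin 4} (h : w ≠ v) : ccwPrev v w ≠ v := by
  revert v w; decide

lemma ccwNext_ne {v w : Fin 4} (h : w ≠ v) : ccwNext v w ≠ w := by
  revert v w; decide

lemma ccwPrev_ne {v w : Fin 4} (h : w ≠ v) : ccwPrev v w ≠ w := by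
  revert v w; decide

lemma ccwNext_ne_ccwPrev {v w : Fin 4} (h : w ≠ v) : ccwNext v w ≠ ccwPrev v w := by
  revert v w; decide

lemma ccwNext_ccwPrev {v w : Fin 4} (h : w ≠ v) : ccwNext v (ccwPrev v w) = w := by
  revert v w; decide

lemma ccwPrev_ccwNext {v w : Fin 4} (h : w ≠ v) : ccwPrev v (ccwNext v w) = w := by
  revert v w; decide

lemma ccwNext_ccwNext (v w : Fin 4) : ccwNext v (ccwNext v w) = ccwPrev v w := rfl

lemma ccwPrev_ccwPrev {v w : Fin 4} (h : w ≠ v) : ccwPrev v (ccwPrev v w) = ccwNext v w := by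
  revert v w; decide

lemma eq_or_eq_ccw {v w a : Fin 4} (h : w ≠ v) (ha : a ≠ v) :
    a = w ∨ a = ccwNext v w ∨ a = ccwPrev v w := by
  revert v w a; decide

lemma ccwNext_odd {σ : Equiv.Perm (Fin 4)} (hσ : Equiv.Perm.sign σ = -1) {v w : Fin 4}
    (h : w ≠ v) : ccwNext (σ v) (σ w) = σ (ccwPrev v w) := by
  revert σ v w; decide

lemma ccwPrev_odd {σ : Equiv.Perm (Fin 4)} (hσ : Equiv.Perm.sign σ = -1) {v w : Fin 4}
    (h : w ≠ v) : ccwPrev (σ v) (σ w) = σ (ccwNext v w) := by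
  rw [← ccwPrev_ccwPrev h, ← ccwNext_odd hσ (ccwPrev_ne_tip h), ← ccwNext_odd hσ h]; rfl

lemma ccwNext_swap {v w : Fin 4} (h : w ≠ v) : ccwNext w v = ccwPrev v w := by
  revert v w; decide

lemma ccwPrev_swap {v w : Fin 4} (h : w ≠ v) : ccwPrev w v = ccwNext v w := by
  revert v w; decide

lemma oppPair_ccwPrev_swap {v w : Fin 4} (h : w ≠ v) :
    oppPair w (ccwPrev w v) = oppPair v (ccwPrev v w) := by
  revert v w; decide

lemma oppVertex_ccwNext (j : Fin 3) (v : Fin 4) :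
    oppVertex j (ccwNext v (oppVertex j v)) = ccwPrev v (oppVertex j v) := by
  revert j v; decide

lemma oppVertex_ccwPrev (j : Fin 3) (v : Fin 4) :
    oppVertex j (ccwPrev v (oppVertex j v)) = ccwNext v (oppVertex j v) := by
  revert j v; decide

lemma sum_tips (j : Fin 3) (v : Fin 4) (F : Fin 4 → ℝ) :
    ∑ u, F u = F v + F (oppVertex j v) + F (ccwNext v (oppVertex j v))
      + F (ccwPrev v (oppVertex j v)) := by
  rw [Fin.sum_univ_four]
  fin_cases j <;> fin_cases v <;> simp [oppVertex, ccwNext, ccwPrev] <;> ring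

/-! ### Colours, and the moves along and across ladders -/

namespace FaceGluing

variable {T : Type*} (G : FaceGluing T)

/-- The cusp triangle on the other side of the side `a` of the cusp triangle `x`. -/
def cross (x : T × Fin 4) (a : Fin 4) : T × Fin 4 := (G.adj x.1 a, G.glue x.1 a x.2)

lemma glue_cross (x : T × Fin 4) (a : Fin 4) :
    G.glue (G.cross x a).1 (G.glue x.1 a a) = (G.glue x.1 a)⁻¹ := G.glue_glue x.1 a

lemma cross_cross (x : T × Fin 4) (a : Fin 4) :
    G.cross (G.cross x a) (G.glue x.1 a a) = x := by
  have h := G.glue_cross x a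
  refine Prod.ext (G.adj_adj x.1 a) ?_
  change G.glue (G.cross x a).1 (G.glue x.1 a a) (G.glue x.1 a x.2) = x.2
  rw [h]; simp

lemma glue_ne_tip {x : T × Fin 4} {a w : Fin 4} (h : w ≠ x.2) :
    G.glue x.1 a w ≠ (G.cross x a).2 := fun e => h ((G.glue x.1 a).injective e)

lemma cuspOf_cross {x : T × Fin 4} {a : Fin 4} (h : a ≠ x.2) :
    G.cuspOf (G.cross x a).1 (G.cross x a).2 = G.cuspOf x.1 x.2 :=
  (Quot.sound ⟨a, h, rfl⟩ : Quot.mk G.TriangleStep x = Quot.mk G.TriangleStep (G.cross x a)).symm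

/-- The corner `w` of the cusp triangle `x`. -/
def corner (x : T × Fin 4) (w : Fin 4) (h : w ≠ x.2) : Corner T := ⟨(x.1, x.2, w), h.symm⟩

lemma sameVertex_cross {x : T × Fin 4} {a w : Fin 4} (h : w ≠ x.2) (ha : a ≠ x.2) (haw : a ≠ w) :
    G.SameVertex (FaceGluing.corner x w h)
      (FaceGluing.corner (G.cross x a) (G.glue x.1 a w) (G.glue_ne_tip h)) :=
  Relation.EqvGen.rel _ _ ⟨a, ha, haw, rfl⟩

lemma cornerStep_symm {c d : Corner T} (h : G.CornerStep c d) : G.CornerStep d c := by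
  obtain ⟨a, ha, haw, hd⟩ := h
  obtain ⟨⟨t, v, w⟩, hvw⟩ := c
  obtain ⟨⟨t', v', w'⟩, hvw'⟩ := d
  simp only [Prod.mk.injEq] at hd ha haw
  obtain ⟨rfl, rfl, rfl⟩ := hd
  refine ⟨G.glue t a a, by simpa using ha, by simpa using haw, ?_⟩
  simp [G.adj_adj, G.glue_glue]

/-- Colours of the edges, as in a veering structure: `wide t` is the pair of wide edges of `t`, and
in each cusp triangle the corner after the wide corner is blue and the one before it is not. -/
structure Coloring where
  wide : T → Fin 3
  blue : T → Fin 4 → Fin 4 → Prop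
  blue_glue : ∀ t a v w, w ≠ v → a ≠ v → a ≠ w →
    (blue (G.adj t a) (G.glue t a v) (G.glue t a w) ↔ blue t v w)
  blue_swap : ∀ t v w, w ≠ v → (blue t w v ↔ blue t v w)
  blue_next : ∀ t v, blue t v (ccwNext v (oppVertex (wide t) v))
  not_blue_prev : ∀ t v, ¬ blue t v (ccwPrev v (oppVertex (wide t) v))

namespace Coloring

variable {G} (C : G.Coloring) (x : T × Fin 4)

/-- The wide corner of a cusp triangle. -/
def apex : Fin 4 := oppVertex (C.wide x.1) x.2

/-- The ladderpole segment of the cusp triangle `x` has blue ends. -/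
def IsBlue : Prop := C.blue x.1 x.2 (C.apex x)

open scoped Classical in
/-- The thin corner of the same colour as the wide corner. -/
def fore : Fin 4 := if C.IsBlue x then ccwNext x.2 (C.apex x) else ccwPrev x.2 (C.apex x)

open scoped Classical in
/-- The thin corner of the other colour; the opposite side is the ladderpole segment. -/
def base : Fin 4 := if C.IsBlue x then ccwPrev x.2 (C.apex x) else ccwNext x.2 (C.apex x)

lemma apex_ne : C.apex x ≠ x.2 := oppVertex_ne _ _

lemma fore_ne : C.fore x ≠ x.2 := by
  unfold fore; split_ifs
  exacts [ccwNext_ne_tip (C.apex_ne x), ccwPrev_ne_tip (C.apex_ne x)]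

lemma base_ne : C.base x ≠ x.2 := by
  unfold base; split_ifs
  exacts [ccwPrev_ne_tip (C.apex_ne x), ccwNext_ne_tip (C.apex_ne x)]

lemma fore_ne_apex : C.fore x ≠ C.apex x := by
  unfold fore; split_ifs
  exacts [ccwNext_ne (C.apex_ne x), ccwPrev_ne (C.apex_ne x)]

lemma base_ne_apex : C.base x ≠ C.apex x := by
  unfold base; split_ifs
  exacts [ccwPrev_ne (C.apex_ne x), ccwNext_ne (C.apex_ne x)]

lemma fore_ne_base : C.fore x ≠ C.base x := by
  unfold base fore; split_ifs
  exacts [ccwNext_ne_ccwPrev (C.apex_ne x), (ccwNext_ne_ccwPrev (C.apex_ne x)).symm]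

lemma eq_apex_or_fore_or_base {a : Fin 4} (ha : a ≠ x.2) :
    a = C.apex x ∨ a = C.fore x ∨ a = C.base x := by
  unfold base fore
  rcases eq_or_eq_ccw (C.apex_ne x) ha with h | h | h <;> split_ifs <;> simp [h]

variable {x}

lemma fore_of_isBlue (h : C.IsBlue x) : C.fore x = ccwNext x.2 (C.apex x) := if_pos h
lemma fore_of_not_isBlue (h : ¬ C.IsBlue x) : C.fore x = ccwPrev x.2 (C.apex x) := if_neg h
lemma base_of_isBlue (h : C.IsBlue x) : C.base x = ccwPrev x.2 (C.apex x) := if_pos h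
lemma base_of_not_isBlue (h : ¬ C.IsBlue x) : C.base x = ccwNext x.2 (C.apex x) := if_neg h

/-- The position of the wide corner on the other side of a side. -/
lemma glue_cases {s : Fin 4} (hs : s ≠ x.2) :
    (G.glue x.1 s s = C.apex (G.cross x s) ∧
      ccwNext (G.cross x s).2 (C.apex (G.cross x s)) = G.glue x.1 s (ccwPrev x.2 s) ∧
      ccwPrev (G.cross x s).2 (C.apex (G.cross x s)) = G.glue x.1 s (ccwNext x.2 s)) ∨
    (G.glue x.1 s s = ccwNext (G.cross x s).2 (C.apex (G.cross x s)) ∧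
      C.apex (G.cross x s) = G.glue x.1 s (ccwNext x.2 s) ∧
      ccwPrev (G.cross x s).2 (C.apex (G.cross x s)) = G.glue x.1 s (ccwPrev x.2 s)) ∨
    (G.glue x.1 s s = ccwPrev (G.cross x s).2 (C.apex (G.cross x s)) ∧
      C.apex (G.cross x s) = G.glue x.1 s (ccwPrev x.2 s) ∧
      ccwNext (G.cross x s).2 (C.apex (G.cross x s)) = G.glue x.1 s (ccwNext x.2 s)) := by
  have h1 : ccwNext (G.cross x s).2 (G.glue x.1 s s) = G.glue x.1 s (ccwPrev x.2 s) :=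
    ccwNext_odd (G.odd x.1 s) hs
  have h2 : ccwPrev (G.cross x s).2 (G.glue x.1 s s) = G.glue x.1 s (ccwNext x.2 s) :=
    ccwPrev_odd (G.odd x.1 s) hs
  have hA := C.apex_ne (G.cross x s)
  rcases eq_or_eq_ccw hA (G.glue_ne_tip hs) with h | h | h
  · left
    rw [h] at h1 h2
    exact ⟨h, h1, h2⟩
  · right; left
    rw [h, ccwPrev_ccwNext hA] at h2
    rw [h] at h1
    exact ⟨h, h2, h1⟩
  · right; right
    rw [h, ccwNext_ccwPrev hA] at h1
    rw [h, ccwPrev_ccwPrev hA] at h2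
    exact ⟨h, h1, h2⟩

lemma blue_cross {s w : Fin 4} (hw : w ≠ x.2) (hs : s ≠ x.2) (hsw : s ≠ w) :
    C.blue (G.cross x s).1 (G.cross x s).2 (G.glue x.1 s w) ↔ C.blue x.1 x.2 w :=
  C.blue_glue x.1 s x.2 w hw hs hsw

lemma blue_ccwNext (x : T × Fin 4) : C.blue x.1 x.2 (ccwNext x.2 (C.apex x)) := C.blue_next _ _

lemma not_blue_ccwPrev (x : T × Fin 4) : ¬ C.blue x.1 x.2 (ccwPrev x.2 (C.apex x)) :=
  C.not_blue_prev _ _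

/-- Crossing the side opposite the wide corner. -/
lemma cross_apex_cases (x : T × Fin 4) :
    (C.IsBlue (G.cross x (C.apex x)) ∧ G.glue x.1 (C.apex x) (C.apex x) =
        ccwNext (G.cross x (C.apex x)).2 (C.apex (G.cross x (C.apex x))) ∧
      C.apex (G.cross x (C.apex x)) = G.glue x.1 (C.apex x) (ccwNext x.2 (C.apex x)) ∧
      ccwPrev (G.cross x (C.apex x)).2 (C.apex (G.cross x (C.apex x))) =
        G.glue x.1 (C.apex x) (ccwPrev x.2 (C.apex x))) ∨
    (¬ C.IsBlue (G.cross x (C.apex x)) ∧ G.glue x.1 (C.apex x) (C.apex x) =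
        ccwPrev (G.cross x (C.apex x)).2 (C.apex (G.cross x (C.apex x))) ∧
      C.apex (G.cross x (C.apex x)) = G.glue x.1 (C.apex x) (ccwPrev x.2 (C.apex x)) ∧
      ccwNext (G.cross x (C.apex x)).2 (C.apex (G.cross x (C.apex x))) =
        G.glue x.1 (C.apex x) (ccwNext x.2 (C.apex x))) := by
  have hs := C.apex_ne x
  have hn := C.blue_cross (ccwNext_ne_tip hs) hs (ccwNext_ne hs).symm
  have hp := C.blue_cross (ccwPrev_ne_tip hs) hs (ccwPrev_ne hs).symm
  have bn := C.blue_ccwNext x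
  have bp := C.not_blue_ccwPrev x
  have bn' := C.blue_ccwNext (G.cross x (C.apex x))
  rcases C.glue_cases hs with ⟨h1, h2, h3⟩ | ⟨h1, h2, h3⟩ | ⟨h1, h2, h3⟩
  -- Gluing reverses the cyclic order, so if the wide corners faced each other across this side, the
  -- red end would follow the wide corner of the neighbour.
  · rw [h2] at bn'; tauto
  · left
    refine ⟨?_, h1, h2, h3⟩
    unfold IsBlue; rw [h2]; tauto
  · right
    refine ⟨?_, h1, h2, h3⟩
    unfold IsBlue; rw [h2]; tauto

/-- The side opposite a wide corner is always glued to a side opposite `fore`, and conversely by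
`glue_fore`. This is what makes `step` invertible. -/
lemma glue_apex (x : T × Fin 4) :
    G.glue x.1 (C.apex x) (C.apex x) = C.fore (G.cross x (C.apex x)) := by
  rcases C.cross_apex_cases x with ⟨h, h1, -⟩ | ⟨h, h1, -⟩
  · rw [h1, C.fore_of_isBlue h]
  · rw [h1, C.fore_of_not_isBlue h]

/-- Crossing the side opposite `fore`. -/
lemma cross_fore_cases (x : T × Fin 4) :
    G.glue x.1 (C.fore x) (C.fore x) = C.apex (G.cross x (C.fore x)) ∧
      ((C.IsBlue x ∧ ccwNext (G.cross x (C.fore x)).2 (C.apex (G.cross x (C.fore x))) =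
          G.glue x.1 (C.fore x) (C.apex x) ∧
        ccwPrev (G.cross x (C.fore x)).2 (C.apex (G.cross x (C.fore x))) =
          G.glue x.1 (C.fore x) (ccwPrev x.2 (C.apex x))) ∨
      (¬ C.IsBlue x ∧ ccwNext (G.cross x (C.fore x)).2 (C.apex (G.cross x (C.fore x))) =
          G.glue x.1 (C.fore x) (ccwNext x.2 (C.apex x)) ∧
        ccwPrev (G.cross x (C.fore x)).2 (C.apex (G.cross x (C.fore x))) =
          G.glue x.1 (C.fore x) (C.apex x))) := by
  have hs := C.apex_ne x
  have bn := C.blue_ccwNext x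
  have bp := C.not_blue_ccwPrev x
  have bn' := C.blue_ccwNext (G.cross x (C.fore x))
  have bp' := C.not_blue_ccwPrev (G.cross x (C.fore x))
  have hf := C.fore_ne x
  have ha := C.blue_cross hs hf (C.fore_ne_apex x)
  by_cases h : C.IsBlue x
  · have e := C.fore_of_isBlue h
    have hp := C.blue_cross (ccwPrev_ne_tip hs) hf (by rw [e]; exact ccwNext_ne_ccwPrev hs)
    have e1 : ccwPrev x.2 (C.fore x) = C.apex x := by rw [e, ccwPrev_ccwNext hs]
    have e2 : ccwNext x.2 (C.fore x) = ccwPrev x.2 (C.apex x) := by rw [e, ccwNext_ccwNext]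
    have h' := h
    unfold IsBlue at h'
    rcases C.glue_cases hf with ⟨h1, h2, h3⟩ | ⟨h1, h2, h3⟩ | ⟨h1, h2, h3⟩
    · rw [e1] at h2; rw [e2] at h3
      exact ⟨h1, .inl ⟨h, h2, h3⟩⟩
    · rw [h3, e1] at bp'; tauto
    · rw [h3, e2] at bn'; tauto
  · have e := C.fore_of_not_isBlue h
    have hp := C.blue_cross (ccwNext_ne_tip hs) hf (by rw [e]; exact (ccwNext_ne_ccwPrev hs).symm)
    have e1 : ccwPrev x.2 (C.fore x) = ccwNext x.2 (C.apex x) := by rw [e, ccwPrev_ccwPrev hs]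
    have e2 : ccwNext x.2 (C.fore x) = C.apex x := by rw [e, ccwNext_ccwPrev hs]
    have h' := h
    unfold IsBlue at h'
    rcases C.glue_cases hf with ⟨h1, h2, h3⟩ | ⟨h1, h2, h3⟩ | ⟨h1, h2, h3⟩
    · rw [e1] at h2; rw [e2] at h3
      exact ⟨h1, .inr ⟨h, h2, h3⟩⟩
    · rw [h3, e1] at bp'; tauto
    · rw [h3, e2] at bn'; tauto

lemma glue_fore (x : T × Fin 4) :
    G.glue x.1 (C.fore x) (C.fore x) = C.apex (G.cross x (C.fore x)) := (C.cross_fore_cases x).1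

/-- Crossing the ladderpole segment. -/
lemma cross_base_cases (x : T × Fin 4) :
    (C.IsBlue x ∧ C.IsBlue (G.cross x (C.base x)) ∧ G.glue x.1 (C.base x) (C.base x) =
        ccwPrev (G.cross x (C.base x)).2 (C.apex (G.cross x (C.base x))) ∧
      C.apex (G.cross x (C.base x)) = G.glue x.1 (C.base x) (ccwNext x.2 (C.apex x))) ∨
    (¬ C.IsBlue x ∧ ¬ C.IsBlue (G.cross x (C.base x)) ∧ G.glue x.1 (C.base x) (C.base x) =
        ccwNext (G.cross x (C.base x)).2 (C.apex (G.cross x (C.base x))) ∧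
      C.apex (G.cross x (C.base x)) = G.glue x.1 (C.base x) (ccwPrev x.2 (C.apex x))) := by
  have hs := C.apex_ne x
  have bn := C.blue_ccwNext x
  have bp := C.not_blue_ccwPrev x
  have bn' := C.blue_ccwNext (G.cross x (C.base x))
  have bp' := C.not_blue_ccwPrev (G.cross x (C.base x))
  have hf := C.base_ne x
  have ha := C.blue_cross hs hf (C.base_ne_apex x)
  by_cases h : C.IsBlue x
  · have e := C.base_of_isBlue h
    have hp := C.blue_cross (ccwNext_ne_tip hs) hf (by rw [e]; exact (ccwNext_ne_ccwPrev hs).symm)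
    have e1 : ccwPrev x.2 (C.base x) = ccwNext x.2 (C.apex x) := by rw [e, ccwPrev_ccwPrev hs]
    have e2 : ccwNext x.2 (C.base x) = C.apex x := by rw [e, ccwNext_ccwPrev hs]
    have h' := h
    unfold IsBlue at h'
    rcases C.glue_cases hf with ⟨h1, h2, h3⟩ | ⟨h1, h2, h3⟩ | ⟨h1, h2, h3⟩
    · rw [h3, e2] at bp'; tauto
    · rw [h3, e1] at bp'; tauto
    · rw [e1] at h2
      refine .inl ⟨h, ?_, h1, h2⟩
      unfold IsBlue; rw [h2]; tauto
  · have e := C.base_of_not_isBlue h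
    have hp := C.blue_cross (ccwPrev_ne_tip hs) hf (by rw [e]; exact ccwNext_ne_ccwPrev hs)
    have e1 : ccwPrev x.2 (C.base x) = C.apex x := by rw [e, ccwPrev_ccwNext hs]
    have e2 : ccwNext x.2 (C.base x) = ccwPrev x.2 (C.apex x) := by rw [e, ccwNext_ccwNext]
    have h' := h
    unfold IsBlue at h'
    rcases C.glue_cases hf with ⟨h1, h2, h3⟩ | ⟨h1, h2, h3⟩ | ⟨h1, h2, h3⟩
    · rw [h2, e1] at bn'; tauto
    · rw [e2] at h2
      refine .inr ⟨h, ?_, h1, h2⟩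
      unfold IsBlue; rw [h2]; tauto
    · rw [h3, e2] at bn'; tauto

lemma glue_base (x : T × Fin 4) :
    G.glue x.1 (C.base x) (C.base x) = C.base (G.cross x (C.base x)) := by
  rcases C.cross_base_cases x with ⟨-, h, h1, -⟩ | ⟨-, h, h1, -⟩
  · rw [h1, C.base_of_isBlue h]
  · rw [h1, C.base_of_not_isBlue h]

lemma isBlue_cross_base (x : T × Fin 4) : C.IsBlue (G.cross x (C.base x)) ↔ C.IsBlue x := by
  rcases C.cross_base_cases x with ⟨h, h', -⟩ | ⟨h, h', -⟩ <;> tauto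

/-- The move along the ladder through the side opposite `fore`. -/
def step : Equiv.Perm (T × Fin 4) where
  toFun x := G.cross x (C.fore x)
  invFun x := G.cross x (C.apex x)
  left_inv x := by
    dsimp only
    rw [← C.glue_fore x, G.cross_cross]
  right_inv x := by
    dsimp only
    rw [← C.glue_apex x, G.cross_cross]

/-- The move across the ladderpole segment. -/
def flip (x : T × Fin 4) : T × Fin 4 := G.cross x (C.base x)

lemma step_apply (x : T × Fin 4) : C.step x = G.cross x (C.fore x) := rfl
lemma step_symm_apply (x : T × Fin 4) : C.step.symm x = G.cross x (C.apex x) := rfl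

lemma flip_flip (x : T × Fin 4) : C.flip (C.flip x) = x := by
  unfold flip; rw [← C.glue_base x, G.cross_cross]

lemma isBlue_flip (x : T × Fin 4) : C.IsBlue (C.flip x) ↔ C.IsBlue x := C.isBlue_cross_base x

lemma cuspOf_step (x : T × Fin 4) :
    G.cuspOf (C.step x).1 (C.step x).2 = G.cuspOf x.1 x.2 := G.cuspOf_cross (C.fore_ne x)

lemma cuspOf_step_symm (x : T × Fin 4) :
    G.cuspOf (C.step.symm x).1 (C.step.symm x).2 = G.cuspOf x.1 x.2 := G.cuspOf_cross (C.apex_ne x)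

lemma cuspOf_flip (x : T × Fin 4) :
    G.cuspOf (C.flip x).1 (C.flip x).2 = G.cuspOf x.1 x.2 := G.cuspOf_cross (C.base_ne x)

lemma isBlue_oppVertex (t : T) (v : Fin 4) :
    C.IsBlue (t, oppVertex (C.wide t) v) ↔ C.IsBlue (t, v) := by
  unfold IsBlue apex
  simp only [oppVertex_oppVertex]
  exact C.blue_swap t v _ (oppVertex_ne _ _)

/-- Opposite thin edges have the same colour: seen from the other end of the wide edge, the corner
before the wide one belongs to the edge opposite to the red edge at `x`. -/
lemma not_blue_opposite (x : T × Fin 4) :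
    ¬ C.blue x.1 (C.apex x) (ccwNext x.2 (C.apex x)) := by
  have h := C.not_blue_prev x.1 (C.apex x)
  have e : ∀ j v, ccwPrev (oppVertex j v) (oppVertex j (oppVertex j v)) =
      ccwNext v (oppVertex j v) := by decide
  unfold apex at h ⊢
  rwa [e] at h

lemma blue_opposite (x : T × Fin 4) :
    C.blue x.1 (C.apex x) (ccwPrev x.2 (C.apex x)) := by
  have h := C.blue_next x.1 (C.apex x)
  have e : ∀ j v, ccwNext (oppVertex j v) (oppVertex j (oppVertex j v)) =
      ccwPrev v (oppVertex j v) := by decide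
  unfold apex at h ⊢
  rwa [e] at h

/-- The colour of the other wide edge is the colour of the preceding triangle in the ladder. -/
lemma isBlue_step_symm (x : T × Fin 4) :
    C.IsBlue (C.step.symm x) ↔ C.IsBlue (x.1, ccwNext x.2 (C.apex x)) := by
  rw [step_symm_apply]
  have hs := C.apex_ne x
  have key : C.IsBlue (x.1, ccwNext x.2 (C.apex x)) ↔
      C.blue (G.cross x (C.apex x)).1 (G.glue x.1 (C.apex x) (ccwNext x.2 (C.apex x)))
        (G.glue x.1 (C.apex x) (ccwPrev x.2 (C.apex x))) := by
    -- The other wide edge lies in the face that is crossed, so its colour can be read in the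
    -- preceding tetrahedron, where it is opposite to a thin edge at the tip of the preceding
    -- triangle.
    rw [show (G.cross x (C.apex x)).1 = G.adj x.1 (C.apex x) from rfl,
      C.blue_glue _ _ _ _ (ccwNext_ne_ccwPrev hs).symm (ccwNext_ne hs).symm (ccwPrev_ne hs).symm]
    unfold IsBlue
    rw [show C.apex (x.1, ccwNext x.2 (C.apex x)) = ccwPrev x.2 (C.apex x) from
      oppVertex_ccwNext _ _]
  rw [key]
  rcases C.cross_apex_cases x with ⟨h, h1, h2, h3⟩ | ⟨h, h1, h2, h3⟩
  · rw [← h2, ← h3]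
    simpa [h] using C.blue_opposite _
  · rw [← h2, ← h3, C.blue_swap _ _ _ (ccwNext_ne (C.apex_ne _))]
    simpa [h] using C.not_blue_opposite _

end Coloring

end FaceGluing

/-! ### Periodic tokens and an invariant weight -/

section InvariantWeight

variable {X : Type*} [Fintype X]

open scoped Classical in
/-- The move of a token in the flow: one step along the ladder, followed by a flip if it arrives
in `L`. -/
def tokenStep (D : Equiv.Perm X) (N : X → X) (L : X → Prop) (y : X) : X :=
  if L (D y) then N (D y) else D y

/-- Here `n + 1` is the first time at which the ladder move reaches `L`; until then the token merely
follows `D`. -/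
lemma exists_exit {D : Equiv.Perm X} {N : X → X} {L : X → Prop}
    (hex : ∀ x, ∃ y, D.SameCycle x y ∧ L y) {y : X} (hy : ¬ L y) :
    ∃ n, L ((D ^ (n + 1)) y) ∧ ¬ L ((D ^ n) y) ∧ (tokenStep D N L)^[n] y = (D ^ n) y := by
  classical
  have h : ∃ n, L ((D ^ n) y) := by
    obtain ⟨z, hz, hLz⟩ := hex y
    obtain ⟨i, -, hi⟩ := hz.exists_pow_eq'
    exact ⟨i, by rwa [hi]⟩
  obtain ⟨n, hn⟩ : ∃ n, Nat.find h = n + 1 := by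
    refine Nat.exists_eq_succ_of_ne_zero fun h0 => hy ?_
    simpa [h0] using Nat.find_spec h
  have hlt : ∀ j, j ≤ n → ¬ L ((D ^ j) y) := fun j hj => Nat.find_min h (by omega)
  refine ⟨n, hn ▸ Nat.find_spec h, hlt n le_rfl, ?_⟩
  have : ∀ j, j ≤ n → (tokenStep D N L)^[j] y = (D ^ j) y := by
    intro j
    induction j with
    | zero => intro _; simp
    | succ j ih =>
      intro hj
      rw [Function.iterate_succ_apply', ih (by omega)]
      have := hlt (j + 1) hj
      rw [pow_succ', Equiv.Perm.mul_apply] at this ⊢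
      exact if_neg this
  exact this n le_rfl

variable {D : Equiv.Perm X} {N : X → X} {L : X → Prop}

omit [Fintype X] in
lemma not_tokenStep (hL : ∀ x, L (N x) ↔ ¬ L x) (y : X) : ¬ L (tokenStep D N L y) := by
  unfold tokenStep; split_ifs with h
  · rw [hL]; exact not_not.2 h
  · exact h

/-- Tokens come back to the ladder where they start. -/
lemma exists_periodic_token (hN : ∀ x, N (N x) = x) (hL : ∀ x, L (N x) ↔ ¬ L x)
    (hex : ∀ x, ∃ y, D.SameCycle x y ∧ L y) (hex' : ∀ x, ∃ y, D.SameCycle x y ∧ ¬ L y)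
    (hσ : ∀ x y, (L x ↔ L y) → D.SameCycle x y → D.SameCycle (N x) (N y)) (x₀ : X) :
    ∃ y d, 0 < d ∧ (tokenStep D N L)^[d] y = y ∧ ¬ L y ∧ D.SameCycle x₀ y := by
  classical
  set ψ := tokenStep D N L with hψ
  let Q := Quotient (Equiv.Perm.SameCycle.setoid D)
  let cls : X → Q := fun x => Quotient.mk _ x
  have hcls : ∀ x y, cls x = cls y ↔ D.SameCycle x y := fun x y => Quotient.eq
  have hch : ∀ q : Q, ∃ x, cls x = q ∧ L x := by
    intro q
    obtain ⟨x, rfl⟩ := Quotient.exists_rep q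
    obtain ⟨y, h1, h2⟩ := hex x
    exact ⟨y, ((hcls x y).2 h1).symm, h2⟩
  choose ch hch1 hch2 using hch
  -- The ladder that a token enters when it leaves the ladder `q`. By `hσ` it does not depend on the
  -- exit chosen, and since `N` is an involution the map is injective, so every ladder is periodic
  -- under it.
  let σ : Q → Q := fun q => cls (N (ch q))
  have hσL : ∀ x, L x → σ (cls x) = cls (N x) := fun x hx =>
    (hcls _ _).2 (hσ _ _ (by simp [hx, hch2]) ((hcls _ _).1 (hch1 _)))
  have hinj : Function.Injective σ := by
    intro q q' h
    have h := hσ _ _ (by simp [hL, hch2]) ((hcls _ _).1 h)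
    rw [hN, hN] at h
    rw [← hch1 q, ← hch1 q', hcls]; exact h
  have hexit : ∀ y, ¬ L y → ∃ k, 1 ≤ k ∧ cls (ψ^[k] y) = σ (cls y) := by
    intro y hy
    obtain ⟨n, h1, -, h3⟩ := exists_exit (N := N) hex hy
    refine ⟨n + 1, by omega, ?_⟩
    have e : ψ^[n + 1] y = N ((D ^ (n + 1)) y) := by
      rw [Function.iterate_succ_apply', h3, hψ, pow_succ', Equiv.Perm.mul_apply]
      rw [pow_succ', Equiv.Perm.mul_apply] at h1
      exact if_pos h1
    rw [e, ← hσL _ h1]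
    congr 1
    rw [hcls, Equiv.Perm.sameCycle_pow_left]
  have hiter : ∀ j y, ¬ L y → ∃ k, j ≤ k ∧ cls (ψ^[k] y) = σ^[j] (cls y) := by
    intro j
    induction j with
    | zero => intro y _; exact ⟨0, le_rfl, rfl⟩
    | succ j ih =>
      intro y hy
      obtain ⟨k, hk, hk'⟩ := hexit y hy
      have hy' : ¬ L (ψ^[k] y) := by
        obtain ⟨k, rfl⟩ := Nat.exists_eq_add_of_le' hk
        rw [Function.iterate_succ_apply']; exact not_tokenStep hL _
      obtain ⟨k', h1, h2⟩ := ih _ hy'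
      refine ⟨k' + k, by omega, ?_⟩
      rw [Function.iterate_add_apply, h2, hk', Function.iterate_succ_apply]
  obtain ⟨y₀, h0, hy₀⟩ := hex' x₀
  obtain ⟨n, hn, hper⟩ := hinj.mem_periodicPts (cls y₀)
  -- The token returns to its initial ladder at unboundedly many times; as `X` is finite, two of
  -- these visits are at the same triangle.
  have hinf : {k | cls (ψ^[k] y₀) = cls y₀}.Infinite := by
    refine Set.infinite_of_not_bddAbove fun ⟨B, hB⟩ => ?_
    obtain ⟨k, h1, h2⟩ := hiter (n * (B + 1)) y₀ hy₀
    rw [(hper.mul_const (B + 1)).eq] at h2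
    have := hB h2
    nlinarith
  obtain ⟨a, ha, b, hb, hab, hne⟩ := hinf.exists_lt_map_eq_of_mapsTo (t := Set.univ)
    (f := fun k => ψ^[k] y₀) (fun _ _ => trivial) Set.finite_univ
  refine ⟨ψ^[a] y₀, b - a, by omega, ?_, ?_, ?_⟩
  · rw [← Function.iterate_add_apply, Nat.sub_add_cancel hab.le]; exact hne.symm
  · cases a with
    | zero => exact hy₀
    | succ a => rw [Function.iterate_succ_apply']; exact not_tokenStep hL _
  · exact h0.trans ((hcls _ _).1 ha).symm

open scoped Classical in
-- The weight is constant on a periodic token orbit, with value the inverse of the number of exits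
-- of the orbit from the ladder of `x₀`. That number is positive because the orbit meets this
-- ladder, which also bounds the weight by 1.
lemma exists_invariant_weight (hN : ∀ x, N (N x) = x) (hL : ∀ x, L (N x) ↔ ¬ L x)
    (hex : ∀ x, ∃ y, D.SameCycle x y ∧ L y) (hex' : ∀ x, ∃ y, D.SameCycle x y ∧ ¬ L y)
    (hσ : ∀ x y, (L x ↔ L y) → D.SameCycle x y → D.SameCycle (N x) (N y)) (x₀ : X) :
    ∃ p : X → ℝ, (∀ x, 0 ≤ p x) ∧ (∀ x, p x ≤ 1) ∧ (∀ x, L x → p x = 0) ∧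
      (∀ x, ¬ L x → p x = p (D.symm x) + p (D.symm (N x))) ∧
      ∑ x with L x ∧ D.SameCycle x₀ x, p (D.symm x) = 1 := by
  obtain ⟨y, d, hd, hper, hy, hxy⟩ := exists_periodic_token hN hL hex hex' hσ x₀
  set ψ := tokenStep D N L with hψ
  let Z : Set X := {z | ∃ j, ψ^[j] y = z}
  have hZψ : ∀ z ∈ Z, ψ z ∈ Z := by
    rintro _ ⟨j, rfl⟩; exact ⟨j + 1, Function.iterate_succ_apply' ..⟩
  have hZd : ∀ z ∈ Z, ψ^[d] z = z := by
    rintro _ ⟨j, rfl⟩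
    rw [← Function.iterate_add_apply, add_comm, Function.iterate_add_apply, hper]
  -- Writing the period as `e + 1` exhibits the `e`-th iterate as a predecessor within the orbit.
  obtain ⟨e, rfl⟩ := Nat.exists_eq_add_of_le' (show 1 ≤ d from hd)
  have hZpre : ∀ z ∈ Z, ∃ z' ∈ Z, ψ z' = z := by
    intro z hz
    have h : ∀ j, ψ^[j] z ∈ Z := by
      intro j
      induction j with
      | zero => exact hz
      | succ j ih => rw [Function.iterate_succ_apply']; exact hZψ _ ih
    exact ⟨_, h e, by rw [← Function.iterate_succ_apply' ψ e z]; exact hZd z hz⟩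
  have hZinj : ∀ z ∈ Z, ∀ z' ∈ Z, ψ z = ψ z' → z = z' := by
    intro z hz z' hz' h
    rw [← hZd z hz, ← hZd z' hz', Function.iterate_succ_apply, Function.iterate_succ_apply, h]
  have hZL : ∀ z ∈ Z, ¬ L z := by
    rintro _ ⟨j, rfl⟩
    cases j with
    | zero => exact hy
    | succ j => rw [Function.iterate_succ_apply']; exact not_tokenStep hL _
  set E : Finset X := {x | (L x ∧ D.SameCycle x₀ x) ∧ D.symm x ∈ Z} with hE
  have hm : 1 ≤ E.card := by
    obtain ⟨n, h1, -, h3⟩ := exists_exit (N := N) hex hy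
    refine Finset.card_pos.2 ⟨(D ^ (n + 1)) y, ?_⟩
    rw [hE, Finset.mem_filter]
    refine ⟨Finset.mem_univ _, ⟨h1, hxy.trans (Equiv.Perm.sameCycle_pow_right.2 (.refl _ _))⟩, n, ?_⟩
    rw [h3, pow_succ', Equiv.Perm.mul_apply, Equiv.symm_apply_apply]
  have hm' : (1 : ℝ) ≤ E.card := by exact_mod_cast hm
  refine ⟨fun x => if x ∈ Z then 1 / E.card else 0, fun x => ?_, fun x => ?_, fun x hx => ?_,
    fun x hx => ?_, ?_⟩
  · dsimp only; split_ifs <;> positivity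
  · dsimp only
    split_ifs
    · rw [div_le_one (by linarith)]; exact hm'
    · norm_num
  · exact if_neg fun h => hZL x h hx
  · have hNx : L (N x) := (hL x).2 hx
    -- A triangle outside `L` has exactly these two predecessors, one in its ladder and one across
    -- the ladderpole. The token map is injective on its periodic orbit, so exactly one of them is
    -- on the orbit if `x` is, and none otherwise.
    have e1 : ψ (D.symm x) = x := by
      rw [hψ, tokenStep, Equiv.apply_symm_apply, if_neg hx]
    have e2 : ψ (D.symm (N x)) = x := by
      rw [hψ, tokenStep, Equiv.apply_symm_apply, if_pos hNx, hN]
    by_cases hxZ : x ∈ Z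
    · have hnb : ¬ (D.symm x ∈ Z ∧ D.symm (N x) ∈ Z) := by
        rintro ⟨h1, h2⟩
        have := D.symm.injective (hZinj _ h1 _ h2 (e1.trans e2.symm))
        rw [← this] at hNx; exact hx hNx
      have hor : D.symm x ∈ Z ∨ D.symm (N x) ∈ Z := by
        obtain ⟨z, hz, hzx⟩ := hZpre x hxZ
        rw [hψ, tokenStep] at hzx
        split_ifs at hzx with h
        · right; rw [← hzx, hN, Equiv.symm_apply_apply]; exact hz
        · left; rw [← hzx, Equiv.symm_apply_apply]; exact hz
      by_cases h1 : D.symm x ∈ Z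
      · have h2 : D.symm (N x) ∉ Z := fun h => hnb ⟨h1, h⟩
        simp [hxZ, h1, h2]
      · have h2 := hor.resolve_left h1
        simp [hxZ, h1, h2]
    · have h1 : D.symm x ∉ Z := fun h => hxZ (e1 ▸ hZψ _ h)
      have h2 : D.symm (N x) ∉ Z := fun h => hxZ (e2 ▸ hZψ _ h)
      simp [hxZ, h1, h2]
  · rw [← Finset.sum_filter, Finset.filter_filter, Finset.sum_const, nsmul_eq_mul, ← hE]
    field_simp

end InvariantWeight

/-! ### Flows on the boundary and the angles they deform -/

namespace FaceGluing

variable {T : Type*} (G : FaceGluing T)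

/-- A flow on the triangulated boundary: `f x a` is the amount that enters the cusp triangle `x`
through its side `a`. -/
structure IsFlow (f : T × Fin 4 → Fin 4 → ℝ) : Prop where
  antisymm : ∀ x a, a ≠ x.2 → f (G.cross x a) (G.glue x.1 a a) = - f x a
  conserve : ∀ x a, a ≠ x.2 → f x a + f x (ccwNext x.2 a) + f x (ccwPrev x.2 a) = 0

end FaceGluing

/-- The leading-trailing deformation of angles by a flow: in each cusp triangle, the angle of each
corner grows by the amount that flows in through the opposite side. -/
def flowAngle {T : Type*} (f : T × Fin 4 → Fin 4 → ℝ) (t : T) (j : Fin 3) : ℝ :=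
  ∑ v, f (t, v) (oppVertex j v)

lemma cornerAngle_flowAngle {T : Type*} (f : T × Fin 4 → Fin 4 → ℝ) (t : T) {v w : Fin 4}
    (h : w ≠ v) : cornerAngle (flowAngle f) t v w =
      f (t, v) w + f (t, w) v + f (t, ccwNext v w) (ccwPrev v w)
        + f (t, ccwPrev v w) (ccwNext v w) := by
  obtain ⟨j, rfl⟩ : ∃ j, w = oppVertex j v := ⟨_, (oppVertex_oppPair h).symm⟩
  unfold cornerAngle flowAngle
  rw [oppPair_oppVertex, sum_tips j v, oppVertex_oppVertex, oppVertex_ccwNext, oppVertex_ccwPrev]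

lemma cornerAngle_add {T : Type*} (θ θ' : T → Fin 3 → ℝ) (t : T) (v w : Fin 4) :
    cornerAngle (θ + θ') t v w = cornerAngle θ t v w + cornerAngle θ' t v w := rfl

namespace FaceGluing

variable {T : Type*} (G : FaceGluing T)

/-- The rotation of the corners around the vertices of the boundary. -/
def rotate : Equiv.Perm (Corner T) where
  toFun c := corner (G.cross (c.1.1, c.1.2.1) (ccwNext c.1.2.1 c.1.2.2))
    (G.glue c.1.1 (ccwNext c.1.2.1 c.1.2.2) c.1.2.2) (G.glue_ne_tip (x := (c.1.1, c.1.2.1)) c.2.symm)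
  invFun c := corner (G.cross (c.1.1, c.1.2.1) (ccwPrev c.1.2.1 c.1.2.2))
    (G.glue c.1.1 (ccwPrev c.1.2.1 c.1.2.2) c.1.2.2) (G.glue_ne_tip (x := (c.1.1, c.1.2.1)) c.2.symm)
  left_inv := by
    rintro ⟨⟨t, v, w⟩, h⟩
    have h' : w ≠ v := Ne.symm h
    apply Subtype.ext
    simp only [corner, cross, ccwPrev_odd (G.odd t _) h', G.adj_adj, G.glue_glue,
      Equiv.Perm.inv_def, Equiv.symm_apply_apply]
  right_inv := by
    rintro ⟨⟨t, v, w⟩, h⟩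
    have h' : w ≠ v := Ne.symm h
    apply Subtype.ext
    simp only [corner, cross, ccwNext_odd (G.odd t _) h', G.adj_adj, G.glue_glue,
      Equiv.Perm.inv_def, Equiv.symm_apply_apply]

lemma sameVertex_rotate (c : Corner T) : G.SameVertex c (G.rotate c) :=
  Relation.EqvGen.rel _ _ ⟨_, ccwNext_ne_tip c.2.symm, ccwNext_ne c.2.symm, rfl⟩

open scoped Classical in
lemma sum_rotate [Fintype T] (c : Corner T) (F : Corner T → ℝ) :
    ∑ d : Corner T with G.SameVertex c d, F (G.rotate d) =
      ∑ d : Corner T with G.SameVertex c d, F d := by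
  refine Finset.sum_equiv G.rotate (fun d => ?_) fun d _ => rfl
  have h := G.sameVertex_rotate d
  simp only [Finset.mem_filter, Finset.mem_univ, true_and]
  exact ⟨fun h' => h'.trans _ _ _ h, fun h' => h'.trans _ _ _ (h.symm _ _)⟩

variable {G} {f : T × Fin 4 → Fin 4 → ℝ}

open scoped Classical in
-- At each corner, conservation at the two ends of its edge rewrites the angle in terms of flows
-- through the two faces containing the edge. Antisymmetry across these faces turns this into
-- differences along the rotation around the vertex, whose sum vanishes.
lemma IsFlow.sum_vertex [Fintype T] (hf : G.IsFlow f) (c : Corner T) :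
    ∑ d : Corner T with G.SameVertex c d,
      cornerAngle (flowAngle f) d.1.1 d.1.2.1 d.1.2.2 = 0 := by
  let A : Corner T → ℝ := fun d => f (d.1.1, d.1.2.1) (ccwNext d.1.2.1 d.1.2.2)
  let A' : Corner T → ℝ := fun d => f (d.1.1, d.1.2.1) (ccwPrev d.1.2.1 d.1.2.2)
  let B : Corner T → ℝ := fun d => f (d.1.1, d.1.2.2) (ccwNext d.1.2.1 d.1.2.2)
  let B' : Corner T → ℝ := fun d => f (d.1.1, d.1.2.2) (ccwPrev d.1.2.1 d.1.2.2)
  let E : Corner T → ℝ := fun d => f (d.1.1, ccwPrev d.1.2.1 d.1.2.2) (ccwNext d.1.2.1 d.1.2.2)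
  let E' : Corner T → ℝ := fun d => f (d.1.1, ccwNext d.1.2.1 d.1.2.2) (ccwPrev d.1.2.1 d.1.2.2)
  have hA : ∀ d, A' (G.rotate d) = - A d := by
    rintro ⟨⟨t, v, w⟩, h⟩
    have h' : w ≠ v := Ne.symm h
    have := hf.antisymm (t, v) (ccwNext v w) (ccwNext_ne_tip h')
    rw [← this]
    simp only [A', rotate, corner, cross, Equiv.coe_fn_mk, ccwPrev_odd (G.odd t _) h']
  have hB : ∀ d, B' (G.rotate d) = - B d := by
    rintro ⟨⟨t, v, w⟩, h⟩
    have h' : w ≠ v := Ne.symm h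
    have := hf.antisymm (t, w) (ccwNext v w) (ccwNext_ne h')
    rw [← this]
    simp only [B', rotate, corner, cross, Equiv.coe_fn_mk, ccwPrev_odd (G.odd t _) h']
  have hE : ∀ d, E' (G.rotate d) = - E d := by
    rintro ⟨⟨t, v, w⟩, h⟩
    have h' : w ≠ v := Ne.symm h
    have := hf.antisymm (t, ccwPrev v w) (ccwNext v w) (ccwNext_ne_ccwPrev h')
    rw [← this]
    simp only [E', rotate, corner, cross, Equiv.coe_fn_mk, ccwPrev_odd (G.odd t _) h',
      ccwNext_odd (G.odd t _) h']
  have key : ∀ d : Corner T, cornerAngle (flowAngle f) d.1.1 d.1.2.1 d.1.2.2 =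
      (A' (G.rotate d) - A' d) + (B' (G.rotate d) - B' d) - (E' (G.rotate d) - E' d) := by
    intro d
    rw [hA, hB, hE]
    obtain ⟨⟨t, v, w⟩, h⟩ := d
    have h' : w ≠ v := Ne.symm h
    rw [cornerAngle_flowAngle f t h']
    have h1 := hf.conserve (t, v) w h'
    have h2 := hf.conserve (t, w) v h
    have e1 := ccwNext_swap h'
    have e2 := ccwPrev_swap h'
    simp only [e1, e2] at h1 h2
    simp only [A, A', B, B', E, E']
    linarith
  rw [Finset.sum_congr rfl fun d _ => key d]
  simp only [Finset.sum_add_distrib, Finset.sum_sub_distrib, G.sum_rotate, sub_self, add_zero]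

lemma IsFlow.sum_tetrahedron (hf : G.IsFlow f) (t : T) :
    flowAngle f t 0 + flowAngle f t 1 + flowAngle f t 2 = 0 := by
  unfold flowAngle
  rw [← Finset.sum_add_distrib, ← Finset.sum_add_distrib]
  refine Finset.sum_eq_zero fun v _ => ?_
  have h := hf.conserve (t, v) (oppVertex 0 v) (oppVertex_ne _ _)
  have e : (oppVertex 1 v = ccwNext v (oppVertex 0 v) ∧ oppVertex 2 v = ccwPrev v (oppVertex 0 v)) ∨
      (oppVertex 1 v = ccwPrev v (oppVertex 0 v) ∧
        oppVertex 2 v = ccwNext v (oppVertex 0 v)) := by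
    clear h; revert v; decide
  rcases e with ⟨h1, h2⟩ | ⟨h1, h2⟩ <;> rw [h1, h2] <;> linarith

end FaceGluing

/-! ### The effect of a flow on the holonomy -/

lemma sum_range_succ_eq_of_periodic {n : ℕ} {F : ℕ → ℝ} (h : F n = F 0) :
    ∑ k ∈ Finset.range n, F (k + 1) = ∑ k ∈ Finset.range n, F k := by
  have h1 := Finset.sum_range_succ F n
  have h2 := Finset.sum_range_succ' F n
  linarith

/-- The amount by which the arc `x` sees the flow `f` cross the normal curve, as measured on the
third side. -/
def NormalArc.sideFlow {T : Type*} (x : NormalArc T) (f : T × Fin 4 → Fin 4 → ℝ) : ℝ :=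
  if ccwPrev x.tip x.enter = x.exit then f (x.tet, x.tip) (ccwNext x.tip x.enter)
  else - f (x.tet, x.tip) (ccwPrev x.tip x.enter)

namespace IdealTriangulation.NormalCurve

variable {T : Type*} {τ : IdealTriangulation T} (ℓ : τ.NormalCurve)

lemma holonomy_eq_sum (θ : T → Fin 3 → ℝ) : ℓ.holonomy θ = ∑ k ∈ Finset.range ℓ.length,
    ((ℓ.arc k).leftAngle θ - (ℓ.arc k).rightAngle θ) := by
  rw [holonomy, leftSum, rightSum, Finset.sum_sub_distrib]

lemma holonomy_add (θ θ' : T → Fin 3 → ℝ) :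
    ℓ.holonomy (θ + θ') = ℓ.holonomy θ + ℓ.holonomy θ' := by
  simp only [holonomy_eq_sum, ← Finset.sum_add_distrib]
  refine Finset.sum_congr rfl fun k _ => ?_
  unfold NormalArc.leftAngle NormalArc.rightAngle
  split_ifs <;> simp [cornerAngle_add] <;> ring

/-- The contributions to the holonomy of the flows at the other tips of the tetrahedra cancel. -/
lemma holonomy_flowAngle {f : T × Fin 4 → Fin 4 → ℝ} (hf : τ.toFaceGluing.IsFlow f) :
    ℓ.holonomy (flowAngle f) = ∑ k ∈ Finset.range ℓ.length, (ℓ.arc k).sideFlow f := by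
  -- The flows through the face that the arc enters, at the two other tips on that face. The gluing
  -- changes the sign of flows and exchanges the two tips, so this difference is the same seen from
  -- either side of the face, and the contributions of the other tips telescope.
  let E : ℕ → ℝ := fun k =>
    f ((ℓ.arc k).tet, ccwPrev (ℓ.arc k).tip (ℓ.arc k).enter) (ℓ.arc k).enter
      - f ((ℓ.arc k).tet, ccwNext (ℓ.arc k).tip (ℓ.arc k).enter) (ℓ.arc k).enter
  have hper : E ℓ.length = E 0 := by
    have := ℓ.periodic 0
    rw [zero_add] at this
    simp only [E, this]
  have hE : ∀ k, E (k + 1) = f ((ℓ.arc k).tet, ccwPrev (ℓ.arc k).tip (ℓ.arc k).exit) (ℓ.arc k).exit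
      - f ((ℓ.arc k).tet, ccwNext (ℓ.arc k).tip (ℓ.arc k).exit) (ℓ.arc k).exit := by
    intro k
    have hx := (ℓ.arc k).exit_ne_tip
    have h1 := hf.antisymm ((ℓ.arc k).tet, ccwPrev (ℓ.arc k).tip (ℓ.arc k).exit) (ℓ.arc k).exit
      (ccwPrev_ne hx).symm
    have h2 := hf.antisymm ((ℓ.arc k).tet, ccwNext (ℓ.arc k).tip (ℓ.arc k).exit) (ℓ.arc k).exit
      (ccwNext_ne hx).symm
    simp only [E, ℓ.tet_succ, ℓ.tip_succ, ℓ.enter_succ, ccwNext_odd (τ.odd _ _) hx,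
      ccwPrev_odd (τ.odd _ _) hx]
    simp only [FaceGluing.cross] at h1 h2
    linarith
  have key : ∀ k, (ℓ.arc k).leftAngle (flowAngle f) - (ℓ.arc k).rightAngle (flowAngle f) =
      (ℓ.arc k).sideFlow f + (E k - E (k + 1)) := by
    intro k
    rw [hE]
    simp only [E]
    generalize ℓ.arc k = x
    obtain ⟨t, v, a, b, ha, hb, hab⟩ := x
    simp only [NormalArc.leftAngle, NormalArc.rightAngle, NormalArc.sideFlow]
    have hn := ccwNext_ne_tip ha
    have hp := ccwPrev_ne_tip ha
    rcases eq_or_eq_ccw ha hb with rfl | rfl | rfl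
    · exact absurd rfl hab
    · rw [if_neg (ccwNext_ne_ccwPrev ha).symm, if_pos rfl, if_neg (ccwNext_ne_ccwPrev ha).symm,
        cornerAngle_flowAngle f t hp]
      have h1 := hf.conserve (t, ccwPrev v a) v hp.symm
      have e1 : ccwNext (ccwPrev v a) v = ccwNext v a := by
        rw [ccwNext_swap hp, ccwPrev_ccwPrev ha]
      have e2 : ccwPrev (ccwPrev v a) v = a := by rw [ccwPrev_swap hp, ccwNext_ccwPrev ha]
      simp only [e1, e2] at h1
      simp only [ccwNext_ccwPrev ha, ccwPrev_ccwPrev ha, ccwNext_ccwNext, ccwPrev_ccwNext ha]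
      linarith
    · rw [if_pos rfl, if_neg (ccwNext_ne_ccwPrev ha), if_pos rfl, cornerAngle_flowAngle f t hn]
      have h1 := hf.conserve (t, ccwNext v a) v hn.symm
      have e1 : ccwNext (ccwNext v a) v = a := by rw [ccwNext_swap hn, ccwPrev_ccwNext ha]
      have e2 : ccwPrev (ccwNext v a) v = ccwPrev v a := by
        rw [ccwPrev_swap hn, ccwNext_ccwNext]
      simp only [e1, e2] at h1
      simp only [ccwNext_ccwPrev ha, ccwPrev_ccwPrev ha, ccwNext_ccwNext, ccwPrev_ccwNext ha]
      linarith
  rw [holonomy_eq_sum, Finset.sum_congr rfl fun k _ => key k, Finset.sum_add_distrib,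
    Finset.sum_sub_distrib, sum_range_succ_eq_of_periodic hper, sub_self, add_zero]

end IdealTriangulation.NormalCurve

/-! ### Corners around a boundary vertex, and adjacent ladders -/

namespace FaceGluing

variable {T : Type*} {G : FaceGluing T}

lemma sameVertex_cross' {x : T × Fin 4} {a w w' : Fin 4} (h : w ≠ x.2) (ha : a ≠ x.2)
    (haw : a ≠ w) (hw' : w' ≠ (G.cross x a).2) (e : w' = G.glue x.1 a w) :
    G.SameVertex (corner x w h) (corner (G.cross x a) w' hw') := by
  subst e; exact G.sameVertex_cross h ha haw

namespace Coloring

variable (C : G.Coloring)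

def apexCorner (x : T × Fin 4) : Corner T := corner x (C.apex x) (C.apex_ne x)

def blueCorner (x : T × Fin 4) : Corner T :=
  corner x (ccwNext x.2 (C.apex x)) (ccwNext_ne_tip (C.apex_ne x))

def redCorner (x : T × Fin 4) : Corner T :=
  corner x (ccwPrev x.2 (C.apex x)) (ccwPrev_ne_tip (C.apex_ne x))

/-- Each vertex of the boundary has exactly two wide corners. -/
structure TwoWide : Prop where
  exists_apex : ∀ c, ∃ x, G.SameVertex c (C.apexCorner x)
  not_three : ∀ x y z, G.SameVertex (C.apexCorner x) (C.apexCorner y) →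
    G.SameVertex (C.apexCorner y) (C.apexCorner z) → x = y ∨ y = z ∨ x = z

/-- The cusp triangles of the ladders along which the transverse orientation and `step` agree. -/
structure IsUpward (A : T × Fin 4 → Prop) : Prop where
  step : ∀ x, A (C.step x) ↔ A x
  flip : ∀ x, A (C.flip x) ↔ ¬ A x
  opp : ∀ x, A (x.1, C.apex x) ↔ A x
  next : ∀ x, A (x.1, ccwNext x.2 (C.apex x)) ↔ ¬ A x

variable {C} {x : T × Fin 4}

lemma sameVertex_apex_blue (h : C.IsBlue x) :
    G.SameVertex (C.apexCorner x) (C.blueCorner (C.step x)) := by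
  obtain ⟨-, ⟨-, h2, -⟩ | ⟨h1, -⟩⟩ := C.cross_fore_cases x
  · exact sameVertex_cross' _ (C.fore_ne x) (C.fore_ne_apex x) _ h2
  · exact absurd h h1

lemma sameVertex_apex_red (h : ¬ C.IsBlue x) :
    G.SameVertex (C.apexCorner x) (C.redCorner (C.step x)) := by
  obtain ⟨-, ⟨h1, -⟩ | ⟨-, -, h2⟩⟩ := C.cross_fore_cases x
  · exact absurd h1 h
  · exact sameVertex_cross' _ (C.fore_ne x) (C.fore_ne_apex x) _ h2

lemma sameVertex_red_red (h : C.IsBlue x) :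
    G.SameVertex (C.redCorner x) (C.redCorner (C.step x)) := by
  obtain ⟨-, ⟨-, -, h2⟩ | ⟨h1, -⟩⟩ := C.cross_fore_cases x
  · refine sameVertex_cross' _ (C.fore_ne x) ?_ _ h2
    rw [C.fore_of_isBlue h]; exact ccwNext_ne_ccwPrev (C.apex_ne x)
  · exact absurd h h1

lemma sameVertex_blue_blue (h : ¬ C.IsBlue x) :
    G.SameVertex (C.blueCorner x) (C.blueCorner (C.step x)) := by
  obtain ⟨-, ⟨h1, -⟩ | ⟨-, h2, -⟩⟩ := C.cross_fore_cases x
  · exact absurd h1 h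
  · refine sameVertex_cross' _ (C.fore_ne x) ?_ _ h2
    rw [C.fore_of_not_isBlue h]; exact (ccwNext_ne_ccwPrev (C.apex_ne x)).symm

lemma sameVertex_blue_flip (h : C.IsBlue x) :
    G.SameVertex (C.blueCorner x) (C.apexCorner (C.flip x)) := by
  obtain ⟨-, -, -, h2⟩ | ⟨h1, -⟩ := C.cross_base_cases x
  · refine sameVertex_cross' _ (C.base_ne x) ?_ _ h2
    rw [C.base_of_isBlue h]; exact (ccwNext_ne_ccwPrev (C.apex_ne x)).symm
  · exact absurd h h1

lemma sameVertex_red_flip (h : ¬ C.IsBlue x) :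
    G.SameVertex (C.redCorner x) (C.apexCorner (C.flip x)) := by
  obtain ⟨h1, -⟩ | ⟨-, -, -, h2⟩ := C.cross_base_cases x
  · exact absurd h1 h
  · refine sameVertex_cross' _ (C.base_ne x) ?_ _ h2
    rw [C.base_of_not_isBlue h]; exact ccwNext_ne_ccwPrev (C.apex_ne x)

/-- The rotation around a vertex from a wide corner to the next wide corner. -/
lemma exists_next_apex [Finite T] (x : T × Fin 4) :
    ∃ n, (C.IsBlue ((C.step ^ (n + 1)) x) ↔ C.IsBlue x) ∧
      (∀ k < n, ¬ (C.IsBlue ((C.step ^ (k + 1)) x) ↔ C.IsBlue x)) ∧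
      G.SameVertex (C.apexCorner x) (C.apexCorner (C.flip ((C.step ^ (n + 1)) x))) := by
  classical
  -- The ladder is finite, so after a full turn the colour of `x` itself recurs.
  have hex : ∃ n, (C.IsBlue ((C.step ^ (n + 1)) x) ↔ C.IsBlue x) := by
    obtain ⟨n, hn⟩ := Nat.exists_eq_add_of_le' (orderOf_pos C.step)
    exact ⟨n, by rw [← hn, pow_orderOf_eq_one]; rfl⟩
  obtain ⟨n, hn, hmin⟩ : ∃ n, (C.IsBlue ((C.step ^ (n + 1)) x) ↔ C.IsBlue x) ∧
      ∀ k < n, ¬ (C.IsBlue ((C.step ^ (k + 1)) x) ↔ C.IsBlue x) :=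
    ⟨Nat.find hex, Nat.find_spec hex, fun k hk => Nat.find_min hex hk⟩
  refine ⟨n, hn, hmin, ?_⟩
  by_cases hx : C.IsBlue x
  · simp only [hx, iff_true] at hn hmin
    -- Up to the next blue triangle, the ladder triangles fan around the vertex with their blue thin
    -- corner; the flip then reaches the next wide corner.
    have : ∀ k ≤ n, G.SameVertex (C.apexCorner x) (C.blueCorner ((C.step ^ (k + 1)) x)) := by
      intro k
      induction k with
      | zero => intro _; simpa using sameVertex_apex_blue hx
      | succ k ih =>
        intro hk
        refine (ih (by omega)).trans _ _ _ ?_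
        rw [pow_succ' _ (k + 1), Equiv.Perm.mul_apply]
        exact sameVertex_blue_blue (hmin k (by omega))
    exact (this n le_rfl).trans _ _ _ (sameVertex_blue_flip hn)
  · simp only [hx, iff_false, not_not] at hn hmin
    have : ∀ k ≤ n, G.SameVertex (C.apexCorner x) (C.redCorner ((C.step ^ (k + 1)) x)) := by
      intro k
      induction k with
      | zero => intro _; simpa using sameVertex_apex_red hx
      | succ k ih =>
        intro hk
        refine (ih (by omega)).trans _ _ _ ?_
        rw [pow_succ' _ (k + 1), Equiv.Perm.mul_apply]
        exact sameVertex_red_red (hmin k (by omega))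
    exact (this n le_rfl).trans _ _ _ (sameVertex_red_flip hn)

variable {A : T × Fin 4 → Prop}

lemma IsUpward.pow (hA : C.IsUpward A) (n : ℕ) (x : T × Fin 4) :
    A ((C.step ^ n) x) ↔ A x := by
  induction n with
  | zero => rfl
  | succ n ih => rw [pow_succ', Equiv.Perm.mul_apply, hA.step, ih]

lemma IsUpward.step_symm (hA : C.IsUpward A) (x : T × Fin 4) : A (C.step.symm x) ↔ A x := by
  rw [← hA.step, Equiv.apply_symm_apply]

/-- Across a ladderpole, triangles of a ladder are in the same ladder. -/
lemma sameCycle_flip [Finite T] (hA : C.IsUpward A) (hC : C.TwoWide) {x y : T × Fin 4}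
    (hxy : C.IsBlue x ↔ C.IsBlue y) (h : C.step.SameCycle x y) :
    C.step.SameCycle (C.flip x) (C.flip y) := by
  have one : ∀ x, ∃ n, (C.IsBlue ((C.step ^ (n + 1)) x) ↔ C.IsBlue x) ∧
      (∀ k < n, ¬ (C.IsBlue ((C.step ^ (k + 1)) x) ↔ C.IsBlue x)) ∧
      C.step.SameCycle (C.flip x) (C.flip ((C.step ^ (n + 1)) x)) := by
    intro x
    obtain ⟨n, h1, h2, h3⟩ := C.exists_next_apex x
    refine ⟨n, h1, h2, ?_⟩
    set y := C.flip ((C.step ^ (n + 1)) x) with hy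
    obtain ⟨m, -, -, h4⟩ := C.exists_next_apex y
    have hAy : A y ↔ ¬ A x := by rw [hy, hA.flip, hA.pow]
    have hAz : A (C.flip ((C.step ^ (m + 1)) y)) ↔ ¬ A y := by rw [hA.flip, hA.pow]
    -- Two successive rotations give three wide corners at one vertex, so two coincide. Consecutive
    -- ones lie in ladders of opposite direction `A`; hence the third is the first, and `C.flip x`
    -- is in the ladder of `y`.
    rcases hC.not_three _ _ _ h3 h4 with e | e | e
    · rw [← e] at hAy; tauto
    · rw [← e] at hAz; tauto
    · have : C.flip x = (C.step ^ (m + 1)) y := by rw [e, C.flip_flip]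
      rw [this]
      exact Equiv.Perm.sameCycle_pow_left.2 (.refl _ _)
  -- Induction on the number of ladder moves from `x` to `y`, jumping each time to the next triangle
  -- of the same colour.
  obtain ⟨i, -, hi⟩ := h.exists_pow_eq'
  induction i using Nat.strong_induction_on generalizing x with
  | _ i ih =>
    rcases Nat.eq_zero_or_pos i with rfl | hpos
    · obtain rfl : x = y := hi
      exact .refl _ _
    · obtain ⟨i, rfl⟩ := Nat.exists_eq_add_of_le' hpos
      obtain ⟨n, h1, h2, h3⟩ := one x
      have hn : n ≤ i := by
        by_contra hlt
        exact h2 i (by omega) (by rw [hi]; exact hxy.symm)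
      refine h3.trans (ih (i - n) (by omega) (h1.trans hxy)
        (Equiv.Perm.sameCycle_pow_left.2 h) ?_)
      rw [← Equiv.Perm.mul_apply, ← pow_add, ← hi]
      congr 2; omega

lemma mem_of_sameVertex {P : Corner T → Prop} (hP : ∀ c d, G.CornerStep c d → P c → P d)
    {c d : Corner T} (h : G.SameVertex c d) : P c ↔ P d := by
  induction h with
  | rel c d h => exact ⟨hP _ _ h, hP _ _ (G.cornerStep_symm h)⟩
  | refl => rfl
  | symm _ _ _ ih => exact ih.symm
  | trans _ _ _ _ _ ih ih' => exact ih.trans ih'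

/-- In a ladder of blue triangles only, the red corners would be closed under rotation around their
vertex, so this vertex would have no wide corner. -/
lemma exists_not_isBlue (hC : C.TwoWide) (x : T × Fin 4) :
    ∃ y, C.step.SameCycle x y ∧ ¬ C.IsBlue y := by
  by_contra! hall
  obtain ⟨w, hw⟩ := hC.exists_apex (C.redCorner x)
  let P : Corner T → Prop := fun c => ∃ z, C.step.SameCycle x z ∧ c = C.redCorner z
  have hP : ∀ c d, G.CornerStep c d → P c → P d := by
    rintro c d ⟨a, h1, h2, h3⟩ ⟨z, hz, rfl⟩
    have ha : a ≠ z.2 := h1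
    have ha' : a ≠ ccwPrev z.2 (C.apex z) := h2
    have hd : d.1 = ((G.cross z a).1, (G.cross z a).2,
      G.glue z.1 a (ccwPrev z.2 (C.apex z))) := h3
    rcases eq_or_eq_ccw (C.apex_ne z) ha with rfl | rfl | rfl
    · have hb := hall _ (Equiv.Perm.sameCycle_symm_apply_right.2 hz)
      rcases C.cross_apex_cases z with ⟨-, -, -, e⟩ | ⟨h, -⟩
      · exact ⟨C.step.symm z, Equiv.Perm.sameCycle_symm_apply_right.2 hz,
          Subtype.ext (hd.trans (by rw [← e]; rfl))⟩
      · exact absurd hb h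
    · have hb := hall _ hz
      rw [← C.fore_of_isBlue hb] at hd
      obtain ⟨-, ⟨-, -, e⟩ | ⟨h, -⟩⟩ := C.cross_fore_cases z
      · exact ⟨C.step z, Equiv.Perm.sameCycle_apply_right.2 hz,
          Subtype.ext (hd.trans (by rw [← e]; rfl))⟩
      · exact absurd hb h
    · exact absurd rfl ha'
  obtain ⟨z, -, e⟩ := (mem_of_sameVertex hP hw).1 ⟨x, .refl _ _, rfl⟩
  have e := congrArg Subtype.val e
  simp only [apexCorner, redCorner, corner, Prod.mk.injEq] at e
  obtain ⟨e1, e2, e3⟩ := e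
  have : w = z := Prod.ext e1 e2
  subst this
  exact ccwPrev_ne (C.apex_ne w) e3.symm

lemma exists_isBlue (hC : C.TwoWide) (x : T × Fin 4) :
    ∃ y, C.step.SameCycle x y ∧ C.IsBlue y := by
  by_contra! hall
  obtain ⟨w, hw⟩ := hC.exists_apex (C.blueCorner x)
  let P : Corner T → Prop := fun c => ∃ z, C.step.SameCycle x z ∧ c = C.blueCorner z
  have hP : ∀ c d, G.CornerStep c d → P c → P d := by
    rintro c d ⟨a, h1, h2, h3⟩ ⟨z, hz, rfl⟩
    have ha : a ≠ z.2 := h1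
    have ha' : a ≠ ccwNext z.2 (C.apex z) := h2
    have hd : d.1 = ((G.cross z a).1, (G.cross z a).2,
      G.glue z.1 a (ccwNext z.2 (C.apex z))) := h3
    rcases eq_or_eq_ccw (C.apex_ne z) ha with rfl | rfl | rfl
    · have hb := hall _ (Equiv.Perm.sameCycle_symm_apply_right.2 hz)
      rcases C.cross_apex_cases z with ⟨h, -⟩ | ⟨-, -, -, e⟩
      · exact absurd h hb
      · exact ⟨C.step.symm z, Equiv.Perm.sameCycle_symm_apply_right.2 hz,
          Subtype.ext (hd.trans (by rw [← e]; rfl))⟩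
    · exact absurd rfl ha'
    · have hb := hall _ hz
      rw [← C.fore_of_not_isBlue hb] at hd
      obtain ⟨-, ⟨h, -⟩ | ⟨-, e, -⟩⟩ := C.cross_fore_cases z
      · exact absurd h hb
      · exact ⟨C.step z, Equiv.Perm.sameCycle_apply_right.2 hz,
          Subtype.ext (hd.trans (by rw [← e]; rfl))⟩
  obtain ⟨z, -, e⟩ := (mem_of_sameVertex hP hw).1 ⟨x, .refl _ _, rfl⟩
  have e := congrArg Subtype.val e
  simp only [apexCorner, blueCorner, corner, Prod.mk.injEq] at e
  obtain ⟨e1, e2, e3⟩ := e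
  have : w = z := Prod.ext e1 e2
  subst this
  exact ccwNext_ne (C.apex_ne w) e3.symm

/-! ### Flows along ladders -/

/-- Given the amounts `g` that flow backwards from `C.step x` to `x`, the amount that enters `x`
through the ladderpole segment. -/
def baseFlow (C : G.Coloring) (g : T × Fin 4 → ℝ) (x : T × Fin 4) : ℝ := g (C.step.symm x) - g x

open scoped Classical in
/-- The flow with the amount `g x` from `C.step x` to `x`. -/
def ladderFlow (C : G.Coloring) (g : T × Fin 4 → ℝ) (x : T × Fin 4) (a : Fin 4) : ℝ :=
  if a = C.fore x then g x else if a = C.apex x then - g (C.step.symm x) else C.baseFlow g x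

variable {g : T × Fin 4 → ℝ}

lemma ladderFlow_fore (x : T × Fin 4) : C.ladderFlow g x (C.fore x) = g x := if_pos rfl

lemma ladderFlow_apex (x : T × Fin 4) :
    C.ladderFlow g x (C.apex x) = - g (C.step.symm x) := by
  rw [ladderFlow, if_neg (C.fore_ne_apex x).symm, if_pos rfl]

lemma ladderFlow_base (x : T × Fin 4) : C.ladderFlow g x (C.base x) = C.baseFlow g x := by
  rw [ladderFlow, if_neg (C.fore_ne_base x).symm, if_neg (C.base_ne_apex x)]

/-- Conservation in triangles is built into `baseFlow`, and antisymmetry across rungs into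
`ladderFlow`; only the ladderpoles impose a condition on `g`. -/
lemma isFlow_ladderFlow (hg : ∀ x, C.baseFlow g (C.flip x) = - C.baseFlow g x) :
    G.IsFlow (C.ladderFlow g) where
  antisymm x a ha := by
    rcases C.eq_apex_or_fore_or_base x ha with rfl | rfl | rfl
    · rw [C.glue_apex, ladderFlow_fore, ladderFlow_apex, neg_neg]; rfl
    · rw [C.glue_fore, ladderFlow_fore, ladderFlow_apex, ← step_apply, Equiv.symm_apply_apply]
    · rw [C.glue_base, ladderFlow_base, ladderFlow_base]; exact hg x
  conserve x a ha := by
    have hW := C.apex_ne x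
    have key : C.ladderFlow g x (C.apex x) + C.ladderFlow g x (ccwNext x.2 (C.apex x))
        + C.ladderFlow g x (ccwPrev x.2 (C.apex x)) = 0 := by
      have h1 : C.ladderFlow g x (C.apex x) + C.ladderFlow g x (C.fore x)
          + C.ladderFlow g x (C.base x) = 0 := by
        rw [ladderFlow_apex, ladderFlow_fore, ladderFlow_base, baseFlow]; ring
      by_cases h : C.IsBlue x
      · rwa [C.fore_of_isBlue h, C.base_of_isBlue h] at h1
      · rw [C.fore_of_not_isBlue h, C.base_of_not_isBlue h] at h1; linarith
    rcases eq_or_eq_ccw hW ha with rfl | rfl | rfl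
    · exact key
    · rw [ccwNext_ccwNext, ccwPrev_ccwNext hW]; linarith
    · rw [ccwNext_ccwPrev hW, ccwPrev_ccwPrev hW]; linarith

/-! ### Nonnegativity of the deformed angles -/

section Nonneg

variable {r : ℝ} (hA : C.IsUpward A) (g0 : ∀ x, 0 ≤ g x) (g1 : ∀ x, g x ≤ r)
  (gL : ∀ x, (A x ↔ C.IsBlue x) → g x = r)
  (hg : ∀ x, C.baseFlow g (C.flip x) = - C.baseFlow g x)

include hA g1 gL hg in
-- The triangle across the ladderpole carries the maximal amount `r`, so nothing can flow into it
-- through the ladderpole.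
lemma baseFlow_nonneg_of_not {x : T × Fin 4} (hx : ¬ (A x ↔ C.IsBlue x)) :
    0 ≤ C.baseFlow g x := by
  have h1 := hg x
  have h2 := gL (C.flip x) (by rw [hA.flip, C.isBlue_flip]; tauto)
  have h3 := g1 (C.step.symm (C.flip x))
  unfold baseFlow at h1 ⊢
  linarith

include hA g1 gL hg in
-- If `x` and its predecessor both have their ladderpole segment on the left, both carry exactly `r`
-- and the difference is zero.
lemma baseFlow_nonneg {x : T × Fin 4} (hx : C.IsBlue (C.step.symm x) ↔ C.IsBlue x) :
    0 ≤ C.baseFlow g x := by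
  by_cases h : A x ↔ C.IsBlue x
  · have h1 := gL x h
    have h2 := gL (C.step.symm x) (by rw [hx, hA.step_symm, h])
    unfold baseFlow; linarith
  · exact baseFlow_nonneg_of_not hA g1 gL hg h

include g1 in
lemma flowAngle_wide (t : T) : - (4 * r) ≤ flowAngle (C.ladderFlow g) t (C.wide t) := by
  unfold flowAngle
  have : ∀ v, C.ladderFlow g (t, v) (oppVertex (C.wide t) v) = - g (C.step.symm (t, v)) :=
    fun v => C.ladderFlow_apex (t, v)
  rw [Finset.sum_congr rfl fun v _ => this v, Fin.sum_univ_four]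
  linarith [g1 (C.step.symm (t, 0)), g1 (C.step.symm (t, 1)), g1 (C.step.symm (t, 2)),
    g1 (C.step.symm (t, 3))]

include hA g0 g1 gL hg in
lemma flowAngle_thin (t : T) {j : Fin 3} (hj : j ≠ C.wide t) :
    0 ≤ flowAngle (C.ladderFlow g) t j := by
  classical
  have hr : 0 ≤ r := (g0 (t, 0)).trans (g1 _)
  -- `κ` says that the thin pair `j` is the blue one. Its corner at a tip is `fore` if the cusp
  -- triangle there has the colour of `j`, and `base` otherwise.
  obtain ⟨κ, hκ⟩ : ∃ κ : Prop, ∀ v, C.ladderFlow g (t, v) (oppVertex j v) =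
      if C.IsBlue (t, v) ↔ κ then g (t, v) else C.baseFlow g (t, v) := by
    have : ∀ w j : Fin 3, j ≠ w → (∀ v, oppVertex j v = ccwNext v (oppVertex w v)) ∨
      (∀ v, oppVertex j v = ccwPrev v (oppVertex w v)) := by decide
    rcases this _ _ hj with h | h
    · refine ⟨True, fun v => ?_⟩
      rw [h v, show oppVertex (C.wide t) v = C.apex (t, v) from rfl]
      by_cases hb : C.IsBlue (t, v)
      · rw [if_pos (by simpa using hb), ← ladderFlow_fore (C := C) (g := g), C.fore_of_isBlue hb]
      · rw [if_neg (by simpa using hb), ← ladderFlow_base (C := C) (g := g), C.base_of_not_isBlue hb]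
    · refine ⟨False, fun v => ?_⟩
      rw [h v, show oppVertex (C.wide t) v = C.apex (t, v) from rfl]
      by_cases hb : C.IsBlue (t, v)
      · rw [if_neg (by simpa using hb), ← ladderFlow_base (C := C) (g := g), C.base_of_isBlue hb]
      · rw [if_pos (by simpa using hb), ← ladderFlow_fore (C := C) (g := g), C.fore_of_not_isBlue hb]
  unfold flowAngle
  rw [Finset.sum_congr rfl fun v _ => hκ v]
  have hlow : ∀ x, - r ≤ C.baseFlow g x := fun x => by
    have h1 := g0 (C.step.symm x)
    have h2 := g1 x
    unfold baseFlow; linarith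
  set a : Fin 4 := ccwNext 0 (oppVertex (C.wide t) 0) with ha
  have hopp : ∀ v, C.IsBlue (t, oppVertex (C.wide t) v) ↔ C.IsBlue (t, v) := C.isBlue_oppVertex t
  have hoppa : oppVertex (C.wide t) a = ccwPrev 0 (oppVertex (C.wide t) 0) := oppVertex_ccwNext _ _
  have hAopp : ∀ v, A (t, oppVertex (C.wide t) v) ↔ A (t, v) := fun v => hA.opp (t, v)
  have hAa : A (t, a) ↔ ¬ A (t, 0) := hA.next (t, 0)
  -- Tips `0` and `a` lie on different wide edges. If these have the same colour, every cusp
  -- triangle of `t` has the colour of its predecessor.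
  by_cases hh : C.IsBlue (t, a) ↔ C.IsBlue (t, 0)
  · have hall : ∀ v, C.IsBlue (t, v) ↔ C.IsBlue (t, 0) := by
      intro v
      by_cases hv : v = 0
      · rw [hv]
      · rcases eq_or_eq_ccw (oppVertex_ne (C.wide t) 0) hv with rfl | rfl | rfl
        · exact hopp 0
        · exact hh
        · rw [← hoppa, hopp, hh]
    refine Finset.sum_nonneg fun v _ => ?_
    split_ifs
    · exact g0 _
    · refine baseFlow_nonneg hA g1 gL hg ?_
      rw [C.isBlue_step_symm, hall, hall v]
  · by_cases hL : A (t, 0) ↔ C.IsBlue (t, 0)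
    · have hall : ∀ v, A (t, v) ↔ C.IsBlue (t, v) := by
        intro v
        by_cases hv : v = 0
        · rw [hv]; exact hL
        · rcases eq_or_eq_ccw (oppVertex_ne (C.wide t) 0) hv with rfl | rfl | rfl
          · rw [hopp, hAopp, hL]
          · tauto
          · rw [← hoppa, hopp, hAopp]; tauto
      rw [sum_tips (C.wide t) 0, ← hoppa, ← ha]
      simp only [hopp]
      have e : ∀ v, g (t, v) = r := fun v => gL _ (hall v)
      have h1 := hlow (t, 0)
      have h2 := hlow (t, oppVertex (C.wide t) 0)
      have h3 := hlow (t, a)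
      have h4 := hlow (t, oppVertex (C.wide t) a)
      -- One wide edge has the colour of `j`: its two tips contribute `r` each, and the two others
      -- at least `-r` each.
      by_cases hk : C.IsBlue (t, 0) ↔ κ
      · have hk' : ¬ (C.IsBlue (t, a) ↔ κ) := by tauto
        simp only [hk, if_true, hk', if_false, e]
        linarith
      · have hk' : C.IsBlue (t, a) ↔ κ := by tauto
        simp only [hk, if_true, hk', if_false, e]
        linarith
    · have hall : ∀ v, ¬ (A (t, v) ↔ C.IsBlue (t, v)) := by
        intro v
        by_cases hv : v = 0
        · rw [hv]; exact hL
        · rcases eq_or_eq_ccw (oppVertex_ne (C.wide t) 0) hv with rfl | rfl | rfl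
          · rw [hopp, hAopp]; exact hL
          · tauto
          · rw [← hoppa, hopp, hAopp]; tauto
      refine Finset.sum_nonneg fun v _ => ?_
      split_ifs
      · exact g0 _
      · exact baseFlow_nonneg_of_not hA g1 gL hg (hall v)

end Nonneg

end Coloring

end FaceGluing

/-! ### From veering and transverse-taut structures to colours and directions -/

namespace IdealTriangulation

variable {T : Type*} [Fintype T] {τ : IdealTriangulation T} {α : T → Fin 3 → ℝ}

lemma IsTaut.exists_wide (hα : τ.IsTaut α) (t : T) :
    ∃ j, ∀ k, α t k = if k = j then Real.pi else 0 := by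
  have h := hα.1.1 t
  have hp := Real.pi_pos
  rcases hα.2 t 0 with h0 | h0 <;> rcases hα.2 t 1 with h1 | h1 <;>
    rcases hα.2 t 2 with h2 | h2 <;> rw [h0, h1, h2] at h <;> try linarith
  · exact ⟨2, fun k => by fin_cases k <;> simp [*]⟩
  · exact ⟨1, fun k => by fin_cases k <;> simp [*]⟩
  · exact ⟨0, fun k => by fin_cases k <;> simp [*]⟩

/-- The pair of wide edges of a tetrahedron. -/
def IsTaut.wide (hα : τ.IsTaut α) (t : T) : Fin 3 := (hα.exists_wide t).choose

lemma IsTaut.angle_eq (hα : τ.IsTaut α) (t : T) (j : Fin 3) :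
    α t j = if j = hα.wide t then Real.pi else 0 := (hα.exists_wide t).choose_spec j

lemma IsTaut.cornerAngle_eq (hα : τ.IsTaut α) (t : T) {v w : Fin 4} (h : w ≠ v) :
    cornerAngle α t v w = if w = oppVertex (hα.wide t) v then Real.pi else 0 := by
  rw [cornerAngle, hα.angle_eq]
  congr 1
  rw [eq_iff_iff]
  constructor
  · intro e; rw [← e, oppVertex_oppPair h]
  · intro e; rw [e, oppPair_oppVertex]

lemma IsTaut.eq_of_cornerAngle (hα : τ.IsTaut α) {t : T} {v w : Fin 4} (h : w ≠ v)
    (hw : cornerAngle α t v w = Real.pi) : w = oppVertex (hα.wide t) v := by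
  by_contra hne
  rw [hα.cornerAngle_eq t h, if_neg hne] at hw
  exact Real.pi_ne_zero hw.symm

lemma IsTaut.cornerAngle_eq_zero (hα : τ.IsTaut α) {t : T} {v w : Fin 4} (h : w ≠ v)
    (hw : w ≠ oppVertex (hα.wide t) v) : cornerAngle α t v w = 0 := by
  rw [hα.cornerAngle_eq t h, if_neg hw]

omit [Fintype T] in
lemma leftVeering_congr {c d : Corner T} (h : τ.SameVertex c d) :
    τ.LeftVeering α c ↔ τ.LeftVeering α d :=
  ⟨fun hc e he => hc e (h.trans _ _ _ he), fun hd e he => hd e ((h.symm _ _).trans _ _ _ he)⟩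

end IdealTriangulation

/-- The other end of the same edge of a tetrahedron. -/
def Corner.swap {T : Type*} (c : Corner T) : Corner T := ⟨(c.1.1, c.1.2.2, c.1.2.1), c.2.symm⟩

lemma FaceGluing.sameVertex_swap {T : Type*} {G : FaceGluing T} {c d : Corner T}
    (h : G.SameVertex c d) : G.SameVertex (Corner.swap c) (Corner.swap d) := by
  induction h with
  | rel c d h =>
    obtain ⟨a, h1, h2, h3⟩ := h
    refine .rel _ _ ⟨a, h2, h1, ?_⟩
    simp only [Corner.swap, h3]
  | refl c => exact .refl _
  | symm _ _ _ ih => exact ih.symm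
  | trans _ _ _ _ _ ih ih' => exact ih.trans _ _ _ ih'

namespace IdealTriangulation

variable {T : Type*} [Fintype T] {τ : IdealTriangulation T} {α : T → Fin 3 → ℝ}

omit [Fintype T] in
lemma LeftVeering.swap {c : Corner T} (h : τ.LeftVeering α c) :
    τ.LeftVeering α (Corner.swap c) := by
  intro d hd h0
  have hd' : τ.SameVertex c (Corner.swap d) := FaceGluing.sameVertex_swap hd
  have h1 := h _ hd' (by rw [← h0]; exact congrArg (α d.1.1) (oppPair_comm _ _))
  rw [← h1]
  exact congrArg (α d.1.1) (oppPair_ccwPrev_swap d.2.symm).symm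

lemma IsTaut.not_left_and_right (hα : τ.IsTaut α) {c : Corner T} {t : T} {v w : Fin 4}
    (hw : w ≠ v) (hne : w ≠ oppVertex (hα.wide t) v)
    (h : τ.SameVertex c (FaceGluing.corner (t, v) w hw)) :
    ¬ (τ.LeftVeering α c ∧ τ.RightVeering α c) := by
  rintro ⟨hl, hr⟩
  have h0 := hα.cornerAngle_eq_zero hw hne
  have h1 := hα.eq_of_cornerAngle (ccwPrev_ne_tip hw) (hl _ h h0)
  have h2 := hα.eq_of_cornerAngle (ccwNext_ne_tip hw) (hr _ h h0)
  exact ccwNext_ne_ccwPrev hw (h2.trans h1.symm)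

/-- The colours of a veering structure. -/
def IsVeering.coloring (hα : τ.IsVeering α) : τ.toFaceGluing.Coloring where
  wide := hα.1.wide
  blue t v w := ∃ h : v ≠ w, τ.LeftVeering α ⟨(t, v, w), h⟩
  blue_glue t a v w hw hav haw := by
    have h := leftVeering_congr (α := α)
      (τ.toFaceGluing.sameVertex_cross (x := (t, v)) (a := a) hw hav haw)
    constructor
    · rintro ⟨_, h'⟩; exact ⟨hw.symm, h.2 h'⟩
    · rintro ⟨_, h'⟩; exact ⟨(τ.toFaceGluing.glue_ne_tip (x := (t, v)) hw).symm, h.1 h'⟩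
  blue_swap t v w hw := ⟨fun ⟨_, h⟩ => ⟨hw.symm, h.swap⟩, fun ⟨_, h⟩ => ⟨hw, h.swap⟩⟩
  blue_next t v := by
    have hW := oppVertex_ne (hα.1.wide t) v
    have hn := ccwNext_ne_tip hW
    refine ⟨hn.symm, (hα.2 _).resolve_right fun hr => ?_⟩
    have h0 := hα.1.cornerAngle_eq_zero hn (ccwNext_ne hW)
    have h1 := hα.1.eq_of_cornerAngle (ccwNext_ne_tip hn) (hr _ (.refl _) h0)
    exact ccwPrev_ne hW h1
  not_blue_prev t v := by
    rintro ⟨h, hl⟩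
    have hW := oppVertex_ne (hα.1.wide t) v
    have hp := ccwPrev_ne_tip hW
    have h0 := hα.1.cornerAngle_eq_zero hp (ccwPrev_ne hW)
    have h1 := hα.1.eq_of_cornerAngle (ccwPrev_ne_tip hp) (hl _ (.refl _) h0)
    rw [ccwPrev_ccwPrev hW] at h1
    exact ccwNext_ne hW h1

variable (hα : τ.IsVeering α)

/-- A thin corner cannot have the wide angle both before and after it. Every vertex has a thin
corner: if `c` is wide, the next triangle in the ladder provides one. -/
lemma IsVeering.not_left_and_right (hα : τ.IsVeering α) (c : Corner T) :
    ¬ (τ.LeftVeering α c ∧ τ.RightVeering α c) := by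
  obtain ⟨⟨t, v, w⟩, h⟩ := c
  have hw : w ≠ v := Ne.symm h
  by_cases hne : w = oppVertex (hα.1.wide t) v
  · let x := (t, v)
    have hc : (⟨(t, v, w), h⟩ : Corner T) = hα.coloring.apexCorner x :=
      by subst hne; rfl
    rw [hc]
    set y := hα.coloring.step x
    have hW : oppVertex (hα.1.wide y.1) y.2 ≠ y.2 := hα.coloring.apex_ne y
    by_cases hb : hα.coloring.IsBlue x
    · exact hα.1.not_left_and_right (t := y.1) (v := y.2) (ccwNext_ne_tip hW) (ccwNext_ne hW)
        (FaceGluing.Coloring.sameVertex_apex_blue hb)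
    · exact hα.1.not_left_and_right (t := y.1) (v := y.2) (ccwPrev_ne_tip hW) (ccwPrev_ne hW)
        (FaceGluing.Coloring.sameVertex_apex_red hb)
  · exact hα.1.not_left_and_right hw hne (.refl _)

/-- The ladderpole segment is not a rung. -/
lemma IsVeering.ne_base_of_isRung {t : T} {v a : Fin 4} (h : τ.IsRung α t v a) :
    a ≠ hα.coloring.base (t, v) := by
  rintro rfl
  obtain ⟨⟨⟨t', v', w⟩, hp⟩, ⟨⟨t'', v'', w'⟩, hq⟩, h1, h2, h3, h4, h5, h6, hl, hr⟩ := h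
  dsimp only at h1 h2 h3 h4 h5 h6
  subst h1 h2 h4 h5
  set C := hα.coloring
  have key : ∀ w, w ≠ v'' → w ≠ C.base (t'', v'') →
      (C.blue t'' v'' w ↔ C.IsBlue (t'', v'')) := by
    intro w hw hwb
    rcases C.eq_apex_or_fore_or_base (t'', v'') hw with rfl | rfl | rfl
    · rfl
    · by_cases hb : C.IsBlue (t'', v'')
      · rw [C.fore_of_isBlue hb]; simpa [hb] using C.blue_ccwNext (t'', v'')
      · rw [C.fore_of_not_isBlue hb]; simpa [hb] using C.not_blue_ccwPrev (t'', v'')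
    · exact absurd rfl hwb
  have hb : C.blue t'' v'' w' := (key w' hq.symm h6).2 ((key w hp.symm h3).1 ⟨hp, hl⟩)
  exact hα.not_left_and_right _ ⟨hb.2, hr⟩

/-- Only wide corners contribute to the angle sum `2π` at a vertex, and each contributes `π`. -/
lemma IsVeering.twoWide : hα.coloring.TwoWide where
  exists_apex c := by
    classical
    by_contra! hno
    have h := hα.1.1.2 c
    rw [Finset.sum_eq_zero] at h
    · linarith [Real.pi_pos]
    · rintro ⟨⟨t, v, w⟩, hvw⟩ hd
      rw [Finset.mem_filter] at hd
      refine hα.1.cornerAngle_eq_zero (Ne.symm hvw) fun e => hno (t, v) ?_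
      dsimp only at e
      subst e
      exact hd.2
  not_three x y z hxy hyz := by
    classical
    by_contra! hne
    have inj : ∀ x y, hα.coloring.apexCorner x = hα.coloring.apexCorner y → x = y := by
      intro x y e
      have e := congrArg Subtype.val e
      simp only [FaceGluing.Coloring.apexCorner, FaceGluing.corner, Prod.mk.injEq] at e
      exact Prod.ext e.1 e.2.1
    have hpi : ∀ x, cornerAngle α (hα.coloring.apexCorner x).1.1
        (hα.coloring.apexCorner x).1.2.1 (hα.coloring.apexCorner x).1.2.2 = Real.pi := by
      intro x
      exact (hα.1.cornerAngle_eq x.1 (hα.coloring.apex_ne x)).trans (if_pos rfl)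
    have h := hα.1.1.2 (hα.coloring.apexCorner x)
    have hsub : ({hα.coloring.apexCorner x, hα.coloring.apexCorner y,
        hα.coloring.apexCorner z} : Finset (Corner T)) ⊆
        Finset.univ.filter fun d => τ.SameVertex (hα.coloring.apexCorner x) d := by
      intro d hd
      simp only [Finset.mem_insert, Finset.mem_singleton] at hd
      rw [Finset.mem_filter]
      refine ⟨Finset.mem_univ _, ?_⟩
      rcases hd with rfl | rfl | rfl
      exacts [.refl _, hxy, hxy.trans _ _ _ hyz]
    have hle := Finset.sum_le_sum_of_subset_of_nonneg (f := fun d : Corner T =>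
      cornerAngle α d.1.1 d.1.2.1 d.1.2.2) hsub fun d _ _ => by
        rcases hα.1.2 d.1.1 (oppPair d.1.2.1 d.1.2.2) with h | h
        · exact h.ge
        · exact Real.pi_pos.le.trans h.ge
    rw [Finset.sum_insert, Finset.sum_insert, Finset.sum_singleton, hpi, hpi, hpi] at hle
    · have h2 : (3 : ℝ) * Real.pi ≤ 2 * Real.pi := by
        rw [← h]; refine le_trans (by linarith) hle
      linarith [Real.pi_pos]
    · simp only [Finset.mem_singleton]
      exact fun e => hne.2.1 (inj _ _ e)
    · simp only [Finset.mem_insert, Finset.mem_singleton, not_or]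
      exact ⟨fun e => hne.1 (inj _ _ e), fun e => hne.2.2 (inj _ _ e)⟩

variable {hα} {inward : T → Fin 4 → Prop}

lemma IsTransverseTaut.faces (hin : τ.IsTransverseTaut α inward) (x : T × Fin 4) :
    (inward x.1 x.2 ↔ inward x.1 (hα.coloring.apex x)) ∧
    (inward x.1 (hα.coloring.fore x) ↔ ¬ inward x.1 (hα.coloring.apex x)) ∧
    (inward x.1 (hα.coloring.base x) ↔ ¬ inward x.1 (hα.coloring.apex x)) := by
  have hpi := (hα.1.cornerAngle_eq x.1 (hα.coloring.apex_ne x)).trans (if_pos rfl)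
  have h := hin.2 x.1 x.2 (hα.coloring.apex x) (hα.coloring.fore x) (hα.coloring.base x) (by
    simp only [List.nodup_cons, List.mem_cons, List.not_mem_nil, or_false, not_or,
      not_false_eq_true, List.nodup_nil, and_true]
    exact ⟨⟨(hα.coloring.apex_ne x).symm, (hα.coloring.fore_ne x).symm,
      (hα.coloring.base_ne x).symm⟩, ⟨(hα.coloring.fore_ne_apex x).symm,
      (hα.coloring.base_ne_apex x).symm⟩, hα.coloring.fore_ne_base x⟩) hpi
  tauto

/-- A ladder move enters by the face `apex` and leaves by the face `fore`, which are oppositely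
oriented relative to the tetrahedron, so the direction persists. The face `base` is oriented like
`fore`, so crossing a ladderpole reverses it. -/
lemma IsTransverseTaut.isUpward (hin : τ.IsTransverseTaut α inward) :
    hα.coloring.IsUpward fun x => inward x.1 (hα.coloring.apex x) where
  step x := by
    have h1 := hin.1 x.1 (hα.coloring.fore x)
    rw [hα.coloring.glue_fore] at h1
    have h2 := hin.faces (hα := hα) x
    exact h1.trans (by tauto)
  flip x := by
    have h1 := hin.1 x.1 (hα.coloring.base x)
    rw [hα.coloring.glue_base] at h1
    have h2 := hin.faces (hα := hα) x
    have h3 := hin.faces (hα := hα) (hα.coloring.flip x)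
    have h1' : inward (hα.coloring.flip x).1 (hα.coloring.base (hα.coloring.flip x)) ↔
      ¬ inward x.1 (hα.coloring.base x) := h1
    tauto
  opp x := by
    have e : hα.coloring.apex (x.1, hα.coloring.apex x) = x.2 := oppVertex_oppVertex _ _
    simp only [e]
    exact (hin.faces (hα := hα) x).1
  next x := by
    have e : hα.coloring.apex (x.1, ccwNext x.2 (hα.coloring.apex x)) =
      ccwPrev x.2 (hα.coloring.apex x) := oppVertex_ccwNext _ _
    simp only [e]
    have h := hin.faces (hα := hα) x
    by_cases hb : hα.coloring.IsBlue x
    · rw [← hα.coloring.base_of_isBlue hb]; exact h.2.2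
    · rw [← hα.coloring.fore_of_not_isBlue hb]; exact h.2.1

end IdealTriangulation

/-! ### Holonomy along the ladders -/

namespace FaceGluing.Coloring

variable {T : Type*} [Fintype T] {G : FaceGluing T} {C : G.Coloring}

lemma cuspOf_sameCycle {x y : T × Fin 4} (h : C.step.SameCycle x y) :
    G.cuspOf y.1 y.2 = G.cuspOf x.1 x.2 := by
  obtain ⟨n, -, rfl⟩ := h.exists_pow_eq'
  induction n with
  | zero => rfl
  | succ n ih =>
    rw [pow_succ', Equiv.Perm.mul_apply, C.cuspOf_step]
    exact ih (Equiv.Perm.sameCycle_pow_right.2 (.refl _ _))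

lemma IsUpward.sameCycle {A : T × Fin 4 → Prop} (hA : C.IsUpward A) {x y : T × Fin 4}
    (h : C.step.SameCycle x y) : A y ↔ A x := by
  obtain ⟨n, -, rfl⟩ := h.exists_pow_eq'
  exact hA.pow n x

open scoped Classical in
/-- The total of the turning over a ladder, in terms of the ladderpole segments on one side. -/
lemma sum_baseFlow (g : T × Fin 4 → ℝ) (L : T × Fin 4 → Prop) (x₀ : T × Fin 4) :
    ∑ x with C.step.SameCycle x₀ x, (if L x then - C.baseFlow g x else C.baseFlow g x) =
      - 2 * ∑ x with L x ∧ C.step.SameCycle x₀ x, C.baseFlow g x := by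
  have h0 : ∑ x with C.step.SameCycle x₀ x, C.baseFlow g x = 0 := by
    simp only [baseFlow, Finset.sum_sub_distrib]
    rw [sub_eq_zero]
    refine Finset.sum_equiv C.step.symm (fun x => ?_) fun x _ => rfl
    simp only [Finset.mem_filter, Finset.mem_univ, true_and]
    exact Equiv.Perm.sameCycle_symm_apply_right.symm
  have h1 : ∀ x, (if L x then - C.baseFlow g x else C.baseFlow g x) =
      C.baseFlow g x - 2 * (if L x then C.baseFlow g x else 0) := by
    intro x; split_ifs <;> ring
  rw [Finset.sum_congr rfl fun x _ => h1 x, Finset.sum_sub_distrib, h0, ← Finset.mul_sum,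
    ← Finset.sum_filter, Finset.filter_filter]
  simp only [and_comm]
  ring

end FaceGluing.Coloring

lemma Equiv.Perm.sum_range_pow {X : Type*} [Fintype X] {E : Equiv.Perm X} {x₀ : X} {n : ℕ}
    (hn : 0 < n) (hper : (E ^ n) x₀ = x₀)
    (hinj : ∀ j k, j < n → k < n → (E ^ j) x₀ = (E ^ k) x₀ → j = k) (F : X → ℝ) :
    ∑ k ∈ Finset.range n, F ((E ^ k) x₀) = open scoped Classical in
      ∑ x with E.SameCycle x₀ x, F x := by
  classical
  rw [← Finset.sum_image (f := F) (g := fun k => (E ^ k) x₀) (s := Finset.range n)]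
  · refine Finset.sum_congr (Finset.ext fun x => ?_) fun _ _ => rfl
    simp only [Finset.mem_image, Finset.mem_range, Finset.mem_filter, Finset.mem_univ, true_and]
    constructor
    · rintro ⟨k, -, rfl⟩
      exact Equiv.Perm.sameCycle_pow_right.2 (.refl _ _)
    · intro h
      obtain ⟨i, -, rfl⟩ := h.exists_pow_eq'
      refine ⟨i % n, Nat.mod_lt _ hn, ?_⟩
      have hmul : ∀ q, (E ^ (n * q)) x₀ = x₀ := by
        intro q
        induction q with
        | zero => rfl
        | succ q ih => rw [Nat.mul_succ, pow_add, Equiv.Perm.mul_apply, hper, ih]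
      conv_rhs => rw [← Nat.mod_add_div i n, pow_add, Equiv.Perm.mul_apply, hmul]
  · intro j hj k hk h
    exact hinj j k (Finset.mem_range.1 hj) (Finset.mem_range.1 hk) h

namespace IdealTriangulation.NormalCurve

variable {T : Type*} [Fintype T] {τ : IdealTriangulation T} {α : T → Fin 3 → ℝ}
  {hα : τ.IsVeering α} {inward : T → Fin 4 → Prop} {ℓ : τ.NormalCurve}

omit [Fintype T] in
lemma exists_arc_eq_succ (ℓ : τ.NormalCurve) (k : ℕ) : ∃ j, ℓ.arc k = ℓ.arc (j + 1) := by
  obtain ⟨m, hm⟩ := Nat.exists_eq_add_of_le' ℓ.length_pos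
  refine ⟨k + m, ?_⟩
  rw [← ℓ.periodic k, hm]; rfl

/-- The cusp triangle of the `k`-th arc. -/
def triangle (ℓ : τ.NormalCurve) (k : ℕ) : T × Fin 4 := ((ℓ.arc k).tet, (ℓ.arc k).tip)

omit [Fintype T] in
lemma triangle_succ (k : ℕ) :
    ℓ.triangle (k + 1) = τ.cross (ℓ.triangle k) (ℓ.arc k).exit :=
  Prod.ext (ℓ.tet_succ k) (ℓ.tip_succ k)

/-- Of the two rungs of a triangle, exactly one lies in an outward face, and an agreeing curve must
leave through it. -/
lemma exit_eq (hin : τ.IsTransverseTaut α inward) (hl : ℓ.IsAlongLadder α)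
    (ho : ℓ.Agrees inward) (k : ℕ) :
    (inward (ℓ.triangle k).1 (hα.coloring.apex (ℓ.triangle k)) ∧
      (ℓ.arc k).exit = hα.coloring.fore (ℓ.triangle k)) ∨
    (¬ inward (ℓ.triangle k).1 (hα.coloring.apex (ℓ.triangle k)) ∧
      (ℓ.arc k).exit = hα.coloring.apex (ℓ.triangle k)) := by
  have h1 := hα.ne_base_of_isRung (hl.1 k)
  have h2 : ¬ inward (ℓ.triangle k).1 (ℓ.arc k).exit := ho k
  have h3 := hin.faces (hα := hα) (ℓ.triangle k)
  rcases hα.coloring.eq_apex_or_fore_or_base (ℓ.triangle k) (ℓ.arc k).exit_ne_tip with h | h | h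
  · rw [h] at h2; exact .inr ⟨h2, h⟩
  · rw [h] at h2; exact .inl ⟨by tauto, h⟩
  · exact absurd h h1

lemma triangle_succ_eq (hin : τ.IsTransverseTaut α inward) (hl : ℓ.IsAlongLadder α)
    (ho : ℓ.Agrees inward) (k : ℕ) :
    (inward (ℓ.triangle k).1 (hα.coloring.apex (ℓ.triangle k)) ∧
      inward (ℓ.triangle (k + 1)).1 (hα.coloring.apex (ℓ.triangle (k + 1))) ∧
      ℓ.triangle (k + 1) = hα.coloring.step (ℓ.triangle k) ∧
      (ℓ.arc (k + 1)).enter = hα.coloring.apex (ℓ.triangle (k + 1))) ∨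
    (¬ inward (ℓ.triangle k).1 (hα.coloring.apex (ℓ.triangle k)) ∧
      ¬ inward (ℓ.triangle (k + 1)).1 (hα.coloring.apex (ℓ.triangle (k + 1))) ∧
      ℓ.triangle (k + 1) = hα.coloring.step.symm (ℓ.triangle k) ∧
      (ℓ.arc (k + 1)).enter = hα.coloring.fore (ℓ.triangle (k + 1))) := by
  have hA := hin.isUpward (hα := hα)
  have he : (ℓ.arc (k + 1)).enter = τ.glue (ℓ.triangle k).1 (ℓ.arc k).exit (ℓ.arc k).exit :=
    ℓ.enter_succ k
  rcases exit_eq (hα := hα) hin hl ho k with ⟨h1, h2⟩ | ⟨h1, h2⟩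
  · left
    have e : ℓ.triangle (k + 1) = hα.coloring.step (ℓ.triangle k) := by
      rw [triangle_succ, h2]; rfl
    refine ⟨h1, ?_, e, ?_⟩
    · rw [e]; exact (hA.step _).2 h1
    · rw [he, h2, e, hα.coloring.glue_fore]; rfl
  · right
    have e : ℓ.triangle (k + 1) = hα.coloring.step.symm (ℓ.triangle k) := by
      rw [triangle_succ, h2]; rfl
    refine ⟨h1, ?_, e, ?_⟩
    · rw [e]; exact fun h => h1 ((hA.step_symm _).1 h)
    · rw [he, h2, e, hα.coloring.glue_apex]; rfl

open scoped Classical in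
-- The curve follows `step` or its inverse throughout, according to the direction of its ladder.
-- Both have the same cycles, and the curve visits each triangle of the cycle once.
lemma sum_triangle (hin : τ.IsTransverseTaut α inward) (hl : ℓ.IsAlongLadder α)
    (ho : ℓ.Agrees inward) (F : T × Fin 4 → ℝ) :
    ∑ k ∈ Finset.range ℓ.length, F (ℓ.triangle k) =
      ∑ x with hα.coloring.step.SameCycle (ℓ.triangle 0) x, F x := by
  have main : ∀ E : Equiv.Perm (T × Fin 4), (∀ k, ℓ.triangle (k + 1) = E (ℓ.triangle k)) →
      ∑ k ∈ Finset.range ℓ.length, F (ℓ.triangle k) =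
        ∑ x with E.SameCycle (ℓ.triangle 0) x, F x := by
    intro E hE
    have hpow : ∀ k, ℓ.triangle k = (E ^ k) (ℓ.triangle 0) := by
      intro k
      induction k with
      | zero => rfl
      | succ k ih => rw [hE, ih, pow_succ', Equiv.Perm.mul_apply]
    rw [Finset.sum_congr rfl fun k _ => congrArg F (hpow k)]
    have hsum := Equiv.Perm.sum_range_pow (E := E) (x₀ := ℓ.triangle 0) ℓ.length_pos ?_ ?_ F
    · convert hsum
    · rw [← hpow]
      have := ℓ.periodic 0
      rw [zero_add] at this
      simp only [triangle, this]
    · intro j k hj hk h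
      rw [← hpow, ← hpow] at h
      exact hl.2 j k hj hk (congrArg Prod.fst h) (congrArg Prod.snd h)
  have hstep := triangle_succ_eq (hα := hα) hin hl ho
  by_cases h0 : inward (ℓ.triangle 0).1 (hα.coloring.apex (ℓ.triangle 0))
  · refine main _ fun k => ?_
    have : inward (ℓ.triangle k).1 (hα.coloring.apex (ℓ.triangle k)) := by
      induction k with
      | zero => exact h0
      | succ k ih => rcases hstep k with h | h <;> tauto
    rcases hstep k with h | h <;> tauto
  · rw [main hα.coloring.step.symm]
    · simp only [← Equiv.Perm.inv_def, Equiv.Perm.sameCycle_inv]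
    · intro k
      have : ¬ inward (ℓ.triangle k).1 (hα.coloring.apex (ℓ.triangle k)) := by
        induction k with
        | zero => exact h0
        | succ k ih => rcases hstep k with h | h <;> tauto
      rcases hstep k with h | h <;> tauto

/-- The arcs of the curve cut off the corner opposite the ladderpole segment. -/
lemma arc_cases (hin : τ.IsTransverseTaut α inward) (hl : ℓ.IsAlongLadder α)
    (ho : ℓ.Agrees inward) (k : ℕ) :
    (¬ (inward (ℓ.triangle k).1 (hα.coloring.apex (ℓ.triangle k)) ↔
        hα.coloring.IsBlue (ℓ.triangle k)) ∧
      ccwPrev (ℓ.arc k).tip (ℓ.arc k).enter = (ℓ.arc k).exit ∧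
      ccwNext (ℓ.arc k).tip (ℓ.arc k).enter = hα.coloring.base (ℓ.triangle k)) ∨
    ((inward (ℓ.triangle k).1 (hα.coloring.apex (ℓ.triangle k)) ↔
        hα.coloring.IsBlue (ℓ.triangle k)) ∧
      ccwNext (ℓ.arc k).tip (ℓ.arc k).enter = (ℓ.arc k).exit ∧
      ccwPrev (ℓ.arc k).tip (ℓ.arc k).enter = hα.coloring.base (ℓ.triangle k)) := by
  have hx := exit_eq (hα := hα) hin hl ho k
  have he : (inward (ℓ.triangle k).1 (hα.coloring.apex (ℓ.triangle k)) ∧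
        (ℓ.arc k).enter = hα.coloring.apex (ℓ.triangle k)) ∨
      (¬ inward (ℓ.triangle k).1 (hα.coloring.apex (ℓ.triangle k)) ∧
        (ℓ.arc k).enter = hα.coloring.fore (ℓ.triangle k)) := by
    obtain ⟨j, hj⟩ := ℓ.exists_arc_eq_succ k
    have ht : ℓ.triangle k = ℓ.triangle (j + 1) := by simp only [triangle, hj]
    rw [ht, hj]
    have := triangle_succ_eq (hα := hα) hin hl ho j
    tauto
  have hW := hα.coloring.apex_ne (ℓ.triangle k)
  have etip : (ℓ.arc k).tip = (ℓ.triangle k).2 := rfl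
  by_cases hb : hα.coloring.IsBlue (ℓ.triangle k)
  · have hf := hα.coloring.fore_of_isBlue hb
    have hbs := hα.coloring.base_of_isBlue hb
    by_cases hA : inward (ℓ.triangle k).1 (hα.coloring.apex (ℓ.triangle k))
    · have h1 : (ℓ.arc k).exit = hα.coloring.fore (ℓ.triangle k) := by tauto
      have h2 : (ℓ.arc k).enter = hα.coloring.apex (ℓ.triangle k) := by tauto
      right
      rw [h1, h2, hf, hbs, etip]
      exact ⟨by tauto, rfl, rfl⟩
    · have h1 : (ℓ.arc k).exit = hα.coloring.apex (ℓ.triangle k) := by tauto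
      have h2 : (ℓ.arc k).enter = hα.coloring.fore (ℓ.triangle k) := by tauto
      left
      rw [h1, h2, hf, hbs, etip]
      exact ⟨by tauto, ccwPrev_ccwNext hW, rfl⟩
  · have hf := hα.coloring.fore_of_not_isBlue hb
    have hbs := hα.coloring.base_of_not_isBlue hb
    by_cases hA : inward (ℓ.triangle k).1 (hα.coloring.apex (ℓ.triangle k))
    · have h1 : (ℓ.arc k).exit = hα.coloring.fore (ℓ.triangle k) := by tauto
      have h2 : (ℓ.arc k).enter = hα.coloring.apex (ℓ.triangle k) := by tauto
      left
      rw [h1, h2, hf, hbs, etip]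
      exact ⟨by tauto, rfl, rfl⟩
    · have h1 : (ℓ.arc k).exit = hα.coloring.apex (ℓ.triangle k) := by tauto
      have h2 : (ℓ.arc k).enter = hα.coloring.fore (ℓ.triangle k) := by tauto
      right
      rw [h1, h2, hf, hbs, etip]
      exact ⟨by tauto, ccwNext_ccwPrev hW, ccwPrev_ccwPrev hW⟩

/-- All corners cut off by the curve are `base` corners, which are thin. -/
lemma holonomy_taut (hα : τ.IsVeering α) (hin : τ.IsTransverseTaut α inward)
    (hl : ℓ.IsAlongLadder α) (ho : ℓ.Agrees inward) : ℓ.holonomy α = 0 := by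
  rw [holonomy_eq_sum]
  refine Finset.sum_eq_zero fun k _ => ?_
  have h0 : cornerAngle α (ℓ.arc k).tet (ℓ.arc k).tip (hα.coloring.base (ℓ.triangle k)) = 0 :=
    hα.1.cornerAngle_eq_zero (hα.coloring.base_ne (ℓ.triangle k))
      (hα.coloring.base_ne_apex (ℓ.triangle k))
  unfold NormalArc.leftAngle NormalArc.rightAngle
  have hne := ccwNext_ne_ccwPrev (ℓ.arc k).enter_ne_tip
  rcases arc_cases (hα := hα) hin hl ho k with ⟨-, h1, h2⟩ | ⟨-, h1, h2⟩
  · rw [if_pos h1, if_neg (by rw [← h1]; exact hne), h2, h0, sub_zero]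
  · rw [if_pos h1, if_neg (by rw [← h1]; exact hne.symm), h2, h0, sub_zero]

open scoped Classical in
lemma holonomy_ladderFlow (hin : τ.IsTransverseTaut α inward) (hl : ℓ.IsAlongLadder α)
    (ho : ℓ.Agrees inward) {g : T × Fin 4 → ℝ}
    (hf : τ.toFaceGluing.IsFlow (hα.coloring.ladderFlow g)) :
    ℓ.holonomy (flowAngle (hα.coloring.ladderFlow g)) =
      - 2 * ∑ x with (inward x.1 (hα.coloring.apex x) ↔ hα.coloring.IsBlue x) ∧
        hα.coloring.step.SameCycle (ℓ.triangle 0) x, hα.coloring.baseFlow g x := by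
  have hs := FaceGluing.Coloring.sum_baseFlow (C := hα.coloring) g
    (fun x => inward x.1 (hα.coloring.apex x) ↔ hα.coloring.IsBlue x) (ℓ.triangle 0)
  have ht := sum_triangle (hα := hα) hin hl ho fun x =>
    if inward x.1 (hα.coloring.apex x) ↔ hα.coloring.IsBlue x
    then - hα.coloring.baseFlow g x else hα.coloring.baseFlow g x
  rw [holonomy_flowAngle ℓ hf]
  refine Eq.trans ?_ (ht.trans (Eq.trans ?_ (hs.trans ?_)))
  rotate_left
  · congr!
  · congr!
  refine Finset.sum_congr rfl fun k _ => ?_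
  have hne := ccwNext_ne_ccwPrev (ℓ.arc k).enter_ne_tip
  have hb := FaceGluing.Coloring.ladderFlow_base (C := hα.coloring) (g := g) (ℓ.triangle k)
  unfold NormalArc.sideFlow
  rcases arc_cases (hα := hα) hin hl ho k with ⟨h0, h1, h2⟩ | ⟨h0, h1, h2⟩
  · rw [if_pos h1, if_neg h0, h2]; exact hb
  · rw [if_neg (by rw [← h1]; exact hne.symm), if_pos h0, h2]; exact congrArg _ hb

end IdealTriangulation.NormalCurve

/-! ### Construction of the angle structure -/

namespace IdealTriangulation

variable {T : Type*} [Fintype T] {τ : IdealTriangulation T} {α : T → Fin 3 → ℝ}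

lemma exists_angleStructure_of_agrees (hα : τ.IsVeering α) {inward : T → Fin 4 → Prop}
    (hin : τ.IsTransverseTaut α inward) (ℓ : τ.Cusp → τ.NormalCurve)
    (hcusp : ∀ i, (ℓ i).InCusp i) (hladder : ∀ i, (ℓ i).IsAlongLadder α)
    (ho : ∀ i, (ℓ i).Agrees inward) (J : Set τ.Cusp) :
    ∃ θ : T → Fin 3 → ℝ, τ.IsNonnegAngleStructure θ ∧
      ∀ i, (i ∈ J → (ℓ i).holonomy θ = Real.pi / 2) ∧ (i ∉ J → (ℓ i).holonomy θ = 0) := by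
  classical
  set C := hα.coloring with hC
  have hA : C.IsUpward fun x => inward x.1 (C.apex x) := hin.isUpward
  have h2 : C.TwoWide := hα.twoWide
  -- By `arc_cases`, these are the triangles whose `base` corner lies to the right of an agreeing
  -- curve, and thus whose ladderpole segment lies to its left.
  let L : T × Fin 4 → Prop := fun x => inward x.1 (C.apex x) ↔ C.IsBlue x
  have hL : ∀ x, L (C.flip x) ↔ ¬ L x := by
    intro x
    have h1 := hA.flip x
    have h3 := C.isBlue_flip x
    simp only [L]
    tauto
  have hex : ∀ x, ∃ y, C.step.SameCycle x y ∧ L y := by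
    intro x
    by_cases hx : inward x.1 (C.apex x)
    · obtain ⟨y, h, hy⟩ := FaceGluing.Coloring.exists_isBlue h2 x
      exact ⟨y, h, iff_of_true ((hA.sameCycle h).2 hx) hy⟩
    · obtain ⟨y, h, hy⟩ := FaceGluing.Coloring.exists_not_isBlue h2 x
      exact ⟨y, h, iff_of_false (fun h' => hx ((hA.sameCycle h).1 h')) hy⟩
  have hex' : ∀ x, ∃ y, C.step.SameCycle x y ∧ ¬ L y := by
    intro x
    by_cases hx : inward x.1 (C.apex x)
    · obtain ⟨y, h, hy⟩ := FaceGluing.Coloring.exists_not_isBlue h2 x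
      exact ⟨y, h, fun h' => hy (h'.1 ((hA.sameCycle h).2 hx))⟩
    · obtain ⟨y, h, hy⟩ := FaceGluing.Coloring.exists_isBlue h2 x
      exact ⟨y, h, fun h' => hx ((hA.sameCycle h).1 (h'.2 hy))⟩
  have hσ : ∀ x y, (L x ↔ L y) → C.step.SameCycle x y →
      C.step.SameCycle (C.flip x) (C.flip y) := by
    intro x y h h'
    have h3 := hA.sameCycle h'
    refine FaceGluing.Coloring.sameCycle_flip hA h2 ?_ h'
    simp only [L] at h
    tauto
  choose p p0 p1 pL pR psum using fun i =>
    exists_invariant_weight C.flip_flip hL hex hex' hσ ((ℓ i).triangle 0)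
  let cusp : T × Fin 4 → τ.Cusp := fun x => τ.cuspOf x.1 x.2
  -- Both moves preserve cusps, so a separate weight, or none, can be used in each cusp.
  let P : T × Fin 4 → ℝ := fun x => if cusp x ∈ J then p (cusp x) x else 0
  have P0 : ∀ x, 0 ≤ P x := fun x => by
    simp only [P]; split_ifs; exacts [p0 _ _, le_rfl]
  have P1 : ∀ x, P x ≤ 1 := fun x => by
    simp only [P]; split_ifs; exacts [p1 _ _, zero_le_one]
  have PL : ∀ x, L x → P x = 0 := fun x hx => by
    simp only [P]; split_ifs; exacts [pL _ _ hx, rfl]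
  have PR : ∀ x, ¬ L x → P x = P (C.step.symm x) + P (C.step.symm (C.flip x)) := by
    intro x hx
    have e1 : cusp (C.step.symm x) = cusp x := C.cuspOf_step_symm x
    have e2 : cusp (C.step.symm (C.flip x)) = cusp x :=
      (C.cuspOf_step_symm _).trans (C.cuspOf_flip x)
    simp only [P, e1, e2]
    split_ifs
    exacts [pR _ _ hx, (add_zero 0).symm]
  -- The largest value for which four tips cannot make a wide angle negative.
  set r : ℝ := Real.pi / 4 with hr
  have hr0 : 0 ≤ r := by positivity
  -- Tokens move forwards, so they are subtracted from the constant backward flow. By `PL` and `PR`,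
  -- the amount entering a triangle outside `L` through its ladderpole segment is `r` times the
  -- token weight crossing there.
  let g : T × Fin 4 → ℝ := fun x => r * (1 - P x)
  have hbase : ∀ x, C.baseFlow g x = r * (P x - P (C.step.symm x)) := by
    intro x; simp only [FaceGluing.Coloring.baseFlow, g]; ring
  have hanti : ∀ x, C.baseFlow g (C.flip x) = - C.baseFlow g x := by
    have key : ∀ x, ¬ L x → C.baseFlow g (C.flip x) = - C.baseFlow g x := by
      intro x hx
      rw [hbase, hbase, PL _ ((hL x).2 hx), PR x hx]; ring
    intro x
    by_cases hx : L x
    · have h := key (C.flip x) (by rw [hL]; exact not_not.2 hx)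
      rw [C.flip_flip] at h
      linarith
    · exact key x hx
  have hflow := FaceGluing.Coloring.isFlow_ladderFlow hanti
  have g0 : ∀ x, 0 ≤ g x := fun x => mul_nonneg hr0 (by linarith [P1 x])
  have g1 : ∀ x, g x ≤ r := fun x => by
    have := mul_nonneg hr0 (P0 x)
    simp only [g]; linarith
  have gL : ∀ x, L x → g x = r := fun x hx => by simp only [g, PL x hx]; ring
  refine ⟨α + flowAngle (C.ladderFlow g), ⟨⟨fun t => ?_, fun c => ?_⟩, fun t j => ?_⟩, fun i => ?_⟩
  · have h3 := hα.1.1.1 t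
    have h4 := hflow.sum_tetrahedron t
    simp only [Pi.add_apply]
    linarith
  · simp only [cornerAngle_add, Finset.sum_add_distrib]
    rw [hflow.sum_vertex c, add_zero]
    exact hα.1.1.2 c
  · simp only [Pi.add_apply, hα.1.angle_eq t j]
    split_ifs with hj
    · have h3 := FaceGluing.Coloring.flowAngle_wide (C := C) g1 t
      rw [hj]
      have : C.wide t = hα.1.wide t := rfl
      rw [this] at h3
      linarith
    · rw [zero_add]
      exact FaceGluing.Coloring.flowAngle_thin hA g0 g1 gL hanti t hj
  · have hh : (ℓ i).holonomy (α + flowAngle (C.ladderFlow g)) =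
        2 * r * ∑ x with L x ∧ C.step.SameCycle ((ℓ i).triangle 0) x, P (C.step.symm x) := by
      rw [NormalCurve.holonomy_add, NormalCurve.holonomy_taut hα hin (hladder i) (ho i),
        NormalCurve.holonomy_ladderFlow hin (hladder i) (ho i) hflow, zero_add, mul_assoc,
        Finset.mul_sum, Finset.mul_sum, Finset.mul_sum]
      refine Finset.sum_congr rfl fun x hx => ?_
      rw [Finset.mem_filter] at hx
      have := hbase x
      rw [PL x hx.2.1] at this
      change -2 * C.baseFlow g x = _
      rw [this]; ring
    have hci : ∀ x, C.step.SameCycle ((ℓ i).triangle 0) x → cusp (C.step.symm x) = i := by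
      intro x hx
      exact (C.cuspOf_step_symm x).trans
        ((FaceGluing.Coloring.cuspOf_sameCycle hx).trans (hcusp i 0))
    rw [hh]
    constructor
    · intro hi
      rw [Finset.sum_congr rfl (g := fun x => p i (C.step.symm x))]
      · have e : ∑ x with L x ∧ C.step.SameCycle ((ℓ i).triangle 0) x, p i (C.step.symm x) = 1 := by
          convert psum i
        rw [e, hr]; ring
      · intro x hx
        rw [Finset.mem_filter] at hx
        simp only [P, hci x hx.2.2, if_pos hi]
    · intro hi
      rw [Finset.sum_eq_zero, mul_zero]
      intro x hx
      rw [Finset.mem_filter] at hx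
      simp only [P, hci x hx.2.2, if_neg hi]

omit [Fintype T] in
lemma IsTransverseTaut.not {inward : T → Fin 4 → Prop} (h : τ.IsTransverseTaut α inward) :
    τ.IsTransverseTaut α fun t f => ¬ inward t f := by
  refine ⟨fun t f => not_congr (h.1 t f), fun t v w a b hn hp => ?_⟩
  have := h.2 t v w a b hn hp
  tauto

end IdealTriangulation

end

theorem proposition5p9 {T : Type*} [Fintype T] (τ : IdealTriangulation T)
    (α : T → Fin 3 → ℝ) (hα : τ.IsVeering α)
    (inward : T → Fin 4 → Prop) (hinward : τ.IsTransverseTaut α inward)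
    (ℓ : τ.Cusp → τ.NormalCurve)
    (hcusp : ∀ i, (ℓ i).InCusp i)
    (hladder : ∀ i, (ℓ i).IsAlongLadder α)
    (horient : (∀ i, (ℓ i).Agrees inward) ∨ (∀ i, (ℓ i).Disagrees inward))
    (J : Set τ.Cusp) :
    ∃ θ : T → Fin 3 → ℝ, τ.IsNonnegAngleStructure θ ∧
      ∀ i, (i ∈ J → (ℓ i).holonomy θ = Real.pi / 2) ∧ (i ∉ J → (ℓ i).holonomy θ = 0) := by
  rcases horient with ho | ho
  · exact IdealTriangulation.exists_angleStructure_of_agrees hα hinward ℓ hcusp hladder ho J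
  -- Reversing all transverse orientations keeps the structure transverse-taut and makes the curves
  -- agree with it.
  · exact IdealTriangulation.exists_angleStructure_of_agrees hα hinward.not ℓ hcusp hladder
      (fun i k => not_not.2 (ho i k)) J
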